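/- Let $N\ge 1$ and, for $d\ge N$, let $P_{d,N}$ be the orthogonal projector of $(\mathbb C^d)^{\otimes N}$ onto the antisymmetric subspace (the vectors that are multiplied by $\operatorname{sgn}\pi$ under every permutation $\pi$ of the $N$ parties), and let $\rho_{d,N}=P_{d,N}/\operatorname{tr}P_{d,N}$. All logarithms are to base $2$. For a state $\rho$ on $\mathcal H_1\otimes\cdots\otimes\mathcal H_N$ let $\mathrm{SEP}$ be the set of fully separable states (convex combinations of tensor products of $N$ single-party states), and put $$\Lambda^2(\rho)=\max_{\sigma\in\mathrm{SEP}}\operatorname{tr}(\rho\sigma),\qquad G(\rho)=-2\log\Lambda(\rho),\qquad E_R(\rho)=\min_{\sigma\in\mathrm{SEP}}\operatorname{tr}\rho(\log\rho-\log\sigma),$$ $$R_L(\rho)=\log(1+R_g(\rho)),\qquad R_g(\rho)=\min\Bigl\{t\ge 0:\ \tfrac{\rho+t\Delta}{1+t}\in\mathrm{SEP}\text{ for some state }\Delta\Bigr\},$$ where the relative entropy in $E_R$ is $+\infty$ unless $\ker\sigma\subseteq\ker\rho$. A closest product state of $\rho$ is a unit product vector $|\varphi\rangle=|a_1\rangle\otimes\cdots\otimes|a_N\rangle$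 with $\langle\varphi|\rho|\varphi\rangle=\Lambda^2(\rho)$. A tensor product of several $N$-partite states is regarded as an $N$-partite state, the $k$-th party holding the $k$-th particles of all factors. Then the following hold. 1. For all $n$ and all $d_1,\dots,d_n\ge N$, $$R_L\Bigl(\bigotimes_{j=1}^n\rho_{d_j,N}\Bigr)=E_R\Bigl(\bigotimes_{j=1}^n\rho_{d_j,N}\Bigr)=G\Bigl(\bigotimes_{j=1}^n\rho_{d_j,N}\Bigr)-\sum_{j=1}^n\log\operatorname{tr}P_{d_j,N}.$$ 2. For $d\ge N$ the limits $E^\infty(\rho_{d,N})=\lim_{n\to\infty}\frac1nE(\rho_{d,N}^{\otimes n})$ exist for $E=R_L,E_R,G$, are finite, and satisfy $R_L^\infty(\rho_{d,N})=E_R^\infty(\rho_{d,N})=G^\infty(\rho_{d,N})-\log\operatorname{tr}P_{d,N}$. 3. For $d\ge N$, $\operatorname{tr}P_{d,N}=\binom dN$ and $$R_L(\rho_{d,N})=E_R(\rho_{d,N})=G(\rho_{d,N})-\log\operatorname{tr}P_{d,N}=\log N!,$$ $$R_L(\rho_{d,N}^{\otimes2})=E_R(\rho_{d,N}^{\otimes2})=G(\rho_{d,N}^{\otimes2})-2\log\operatorname{tr}P_{d,N}=\log\frac{d^N\,N!\,(d-N)!}{d!}.$$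 4. For $d\ge N$, a vector is a closest product state of $\rho_{d,N}$ if and only if it is a tensor product $|a_1\rangle\otimes\cdots\otimes|a_N\rangle$ of orthonormal single-particle states. 5. For $d\ge N$ and every maximally entangled state $|\psi\rangle\in\mathbb C^d\otimes\mathbb C^d$ (one whose reduced states are $I/d$), the product $|\psi\rangle^{\otimes N}$, in which each party holds one copy of $|\psi\rangle$ shared between its two particles, is a closest product state of $\rho_{d,N}^{\otimes2}$. If $N\ge3$, every closest product state of $\rho_{d,N}^{\otimes2}$ is of this form. -/

import Mathlib

open scoped ComplexOrder

noncomputable section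

namespace Multipartite

/-! An `N`-partite quantum system whose parties all have the single-particle Hilbert space
`ℂ^ι = EuclideanSpace ℂ ι` has the joint Hilbert space `EuclideanSpace ℂ (Fin N → ι)`, the
computational basis being indexed by `x : Fin N → ι`. Operators are matrices in this basis. -/

/-- A (mixed) quantum state: a positive semidefinite matrix of trace one. -/
def IsState {α : Type*} [Fintype α] (ρ : Matrix α α ℂ) : Prop :=
  ρ.PosSemidef ∧ ρ.trace = 1

/-- The product vector `|a₁⟩ ⊗ ⋯ ⊗ |a_N⟩`. -/
def productVector {N : ℕ} {ι : Type*} [Fintype ι] (a : Fin N → EuclideanSpace ℂ ι) :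
    EuclideanSpace ℂ (Fin N → ι) :=
  WithLp.toLp 2 fun x => ∏ k, a k (x k)

/-- The tensor product `A₁ ⊗ ⋯ ⊗ A_N` of single-particle operators. -/
def productMatrix {N : ℕ} {ι : Type*} (A : Fin N → Matrix ι ι ℂ) :
    Matrix (Fin N → ι) (Fin N → ι) ℂ :=
  Matrix.of fun x y => ∏ k, A k (x k) (y k)

/-- The set `SEP` of fully separable states: convex mixtures of products of single-particle
states. -/
def separableStates (N : ℕ) (ι : Type*) [Fintype ι] : Set (Matrix (Fin N → ι) (Fin N → ι) ℂ) :=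
  convexHull ℝ {σ | ∃ A : Fin N → Matrix ι ι ℂ, (∀ k, IsState (A k)) ∧ σ = productMatrix A}

/-- The set `PRO` of fully product pure states, represented by unit vectors. -/
def productStates (N : ℕ) (ι : Type*) [Fintype ι] : Set (EuclideanSpace ℂ (Fin N → ι)) :=
  {φ | ∃ a : Fin N → EuclideanSpace ℂ ι, (∀ k, ‖a k‖ = 1) ∧ φ = productVector a}

/-- The expectation value `⟨φ|ρ|φ⟩`. -/
def expectation {α : Type*} [Fintype α] (ρ : Matrix α α ℂ) (φ : EuclideanSpace ℂ α) : ℝ :=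
  (star φ.ofLp ⬝ᵥ (ρ.mulVec φ.ofLp)).re

section Measures

variable {N : ℕ} {ι : Type*} [Fintype ι] [DecidableEq ι]

/-- `Λ²(ρ) = max_{σ ∈ SEP} tr(ρσ)`. -/
def maxOverlapSq (ρ : Matrix (Fin N → ι) (Fin N → ι) ℂ) : ℝ :=
  sSup ((fun σ => (ρ * σ).trace.re) '' separableStates N ι)

/-- The geometric measure `G(ρ) = -2 log₂ Λ(ρ)`. -/
def geometricMeasure (ρ : Matrix (Fin N → ι) (Fin N → ι) ℂ) : ℝ :=
  -2 * Real.logb 2 (Real.sqrt (maxOverlapSq ρ))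

/-- `φ` is a closest product state of `ρ`: a pure product state attaining `Λ²(ρ)`. -/
def IsClosestProductState (ρ : Matrix (Fin N → ι) (Fin N → ι) ℂ)
    (φ : EuclideanSpace ℂ (Fin N → ι)) : Prop :=
  φ ∈ productStates N ι ∧ expectation ρ φ = maxOverlapSq ρ

/-- The base-2 logarithm of a positive semidefinite matrix, by functional calculus. It is zero on
the kernel (`Real.logb 2 0 = 0`), the usual convention in the relative entropy. -/
def matrixLog {α : Type*} [Fintype α] [DecidableEq α] (A : Matrix α α ℂ) : Matrix α α ℂ :=
  cfc (Real.logb 2) A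

open Classical in
/-- The quantum relative entropy `S(ρ‖σ) = tr ρ (log₂ ρ - log₂ σ)`, which is `+∞` unless the
kernel of `σ` is contained in the kernel of `ρ`. -/
def relativeEntropy {α : Type*} [Fintype α] [DecidableEq α] (ρ σ : Matrix α α ℂ) : EReal :=
  if ∀ v : α → ℂ, σ.mulVec v = 0 → ρ.mulVec v = 0 then
    (((ρ * (matrixLog ρ - matrixLog σ)).trace.re : ℝ) : EReal)
  else ⊤

/-- The relative entropy of entanglement `E_R(ρ) = min_{σ ∈ SEP} S(ρ‖σ)`. -/
def relativeEntropyOfEntanglement (ρ : Matrix (Fin N → ι) (Fin N → ι) ℂ) : EReal :=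
  ⨅ σ ∈ separableStates N ι, relativeEntropy ρ σ

/-- The global robustness `R_g(ρ)`: the least `t ≥ 0` such that `(ρ + tΔ)/(1 + t)` is separable
for some state `Δ`. -/
def globalRobustness (ρ : Matrix (Fin N → ι) (Fin N → ι) ℂ) : ℝ :=
  sInf {t : ℝ | 0 ≤ t ∧ ∃ Δ : Matrix (Fin N → ι) (Fin N → ι) ℂ, IsState Δ ∧
    (1 + t)⁻¹ • (ρ + t • Δ) ∈ separableStates N ι}

/-- The logarithmic global robustness `R_L(ρ) = log₂ (1 + R_g(ρ))`. -/
def logGlobalRobustness (ρ : Matrix (Fin N → ι) (Fin N → ι) ℂ) : ℝ :=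
  Real.logb 2 (1 + globalRobustness ρ)

end Measures

/-- The tensor product `⨂ⱼ ρⱼ` of `N`-partite states, regarded as an `N`-partite state: the `k`-th
party holds the `k`-th particles of all the factors, so its local basis is `∀ j, ι j`. -/
def tensorState {N n : ℕ} {ι : Fin n → Type*}
    (ρ : ∀ j, Matrix (Fin N → ι j) (Fin N → ι j) ℂ) :
    Matrix (Fin N → ∀ j, ι j) (Fin N → ∀ j, ι j) ℂ :=
  Matrix.of fun x y => ∏ j, ρ j (fun k => x k j) (fun k => y k j)

/-- `ρ^{⊗n}` as an `N`-partite state. -/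
def copies {N : ℕ} {ι : Type*} (n : ℕ) (ρ : Matrix (Fin N → ι) (Fin N → ι) ℂ) :
    Matrix (Fin N → Fin n → ι) (Fin N → Fin n → ι) ℂ :=
  tensorState fun _ : Fin n => ρ

/-- The antisymmetric subspace of `(ℂ^d)^{⊗N}`: permuting the parties by `π` multiplies the vector
by the sign of `π`. -/
def antisymmetricSubspace (d N : ℕ) : Submodule ℂ (EuclideanSpace ℂ (Fin N → Fin d)) where
  carrier := {ψ | ∀ (π : Equiv.Perm (Fin N)) (x : Fin N → Fin d),
    ψ (x ∘ π) = ((Equiv.Perm.sign π : ℤ) : ℂ) * ψ x}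
  add_mem' := by
    intro ψ χ hψ hχ π x
    simp only [PiLp.add_apply, hψ π x, hχ π x, mul_add]
  zero_mem' := by
    intro π x
    simp
  smul_mem' := by
    intro c ψ hψ π x
    simp only [PiLp.smul_apply, hψ π x, smul_eq_mul]
    ring

/-- `P_{d,N}`, the matrix of the orthogonal projector onto the antisymmetric subspace. -/
def antisymmetricProjector (d N : ℕ) : Matrix (Fin N → Fin d) (Fin N → Fin d) ℂ :=
  (Matrix.toEuclideanCLM (n := Fin N → Fin d) (𝕜 := ℂ)).symm
    (antisymmetricSubspace d N).starProjection

/-- The antisymmetric projector state `ρ_{d,N} = P_{d,N} / tr P_{d,N}`. -/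
def antisymmetricProjectorState (d N : ℕ) : Matrix (Fin N → Fin d) (Fin N → Fin d) ℂ :=
  ((antisymmetricProjector d N).trace)⁻¹ • antisymmetricProjector d N

/-- The reduced state on the first factor of the pure state `ψ ∈ ℂ^d ⊗ ℂ^d`. -/
def reducedStateFirst {d : ℕ} (ψ : EuclideanSpace ℂ (Fin 2 → Fin d)) :
    Matrix (Fin d) (Fin d) ℂ :=
  Matrix.of fun a a' => ∑ b, ψ ![a, b] * star (ψ ![a', b])

/-- `ψ ∈ ℂ^d ⊗ ℂ^d` is maximally entangled: its reduced state is the maximally mixed state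
`I / d`. -/
def IsMaximallyEntangled {d : ℕ} (ψ : EuclideanSpace ℂ (Fin 2 → Fin d)) : Prop :=
  reducedStateFirst ψ = (d : ℂ)⁻¹ • (1 : Matrix (Fin d) (Fin d) ℂ)

end Multipartite

end

/-!
Suppose `ρ = Q / tr Q` for an orthogonal projector `Q`, and that twirling with finitely many local
unitaries `K = U ⊗ ⋯ ⊗ U` sends every operator `X` to some `X'` for which `X' * Q` is a multiple of
`Q`. Twirling a closest product state then gives a separable `σ` with `σ Q = Λ²(ρ) Q`. This single
`σ` is optimal for `E_R` and, because `Λ²(ρ) Q ≤ σ`, also for the robustness, and both measures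
equal `G(ρ) - log tr Q`. For antisymmetric projectors the signed permutation matrices are enough,
and for tensor products of them the products of such matrices.

The overlap of a product vector with one copy is a Gram determinant, which Hadamard's inequality
bounds. For two copies, writing each local vector as a matrix turns the overlap into the squared
norm of `P (A₁ ⊗ ⋯ ⊗ A_N) P`. Removing one particle at a time bounds it by its value at
`A_k A_kᴴ = I / d`; equality propagates to every pair of factors and, for three or more factors,
forces all of them to be proportional to a single such matrix.
-/

noncomputable section

namespace Multipartite

open Matrix

section PiKronecker

theorem prod_univ_sum_univ {J R : Type*} {κ : J → Type*} [Fintype J] [DecidableEq J]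
    [∀ j, Fintype (κ j)] [CommSemiring R] (f : ∀ j, κ j → R) :
    ∏ j, ∑ i, f j i = ∑ x : ∀ j, κ j, ∏ j, f j (x j) := by
  rw [Finset.prod_univ_sum, Fintype.piFinset_univ]

variable {J : Type*} [Fintype J] {κ : J → Type*}

/-- The Kronecker product of a finite family of matrices. Both the tensor product over the parties
and the tensor product over the copies are instances of it. -/
def piKronecker (A : ∀ j, Matrix (κ j) (κ j) ℂ) : Matrix (∀ j, κ j) (∀ j, κ j) ℂ :=
  Matrix.of fun x y => ∏ j, A j (x j) (y j)

theorem piKronecker_apply (A : ∀ j, Matrix (κ j) (κ j) ℂ) (x y : ∀ j, κ j) :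
    piKronecker A x y = ∏ j, A j (x j) (y j) := rfl

theorem conjTranspose_piKronecker (A : ∀ j, Matrix (κ j) (κ j) ℂ) :
    (piKronecker A)ᴴ = piKronecker fun j => (A j)ᴴ := by
  ext x y
  simp only [conjTranspose_apply, piKronecker_apply, star_prod]

theorem piKronecker_one [∀ j, DecidableEq (κ j)] :
    piKronecker (fun j => (1 : Matrix (κ j) (κ j) ℂ)) = 1 := by
  ext x y
  simp only [piKronecker_apply, Matrix.one_apply, Finset.prod_boole, Finset.mem_univ, true_imp_iff,
    funext_iff]

variable [DecidableEq J] [∀ j, Fintype (κ j)]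

theorem piKronecker_mul (A B : ∀ j, Matrix (κ j) (κ j) ℂ) :
    piKronecker A * piKronecker B = piKronecker fun j => A j * B j := by
  ext x y
  simp only [piKronecker_apply, Matrix.mul_apply, prod_univ_sum_univ, Finset.prod_mul_distrib]

theorem trace_piKronecker (A : ∀ j, Matrix (κ j) (κ j) ℂ) :
    (piKronecker A).trace = ∏ j, (A j).trace := by
  simp only [Matrix.trace, diag_apply, piKronecker_apply, prod_univ_sum_univ]

theorem piKronecker_mem_unitaryGroup [∀ j, DecidableEq (κ j)] {A : ∀ j, Matrix (κ j) (κ j) ℂ}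
    (hA : ∀ j, A j ∈ unitaryGroup (κ j) ℂ) : piKronecker A ∈ unitaryGroup (∀ j, κ j) ℂ := by
  simp only [mem_unitaryGroup_iff, star_eq_conjTranspose] at hA ⊢
  simp only [conjTranspose_piKronecker, piKronecker_mul, hA, piKronecker_one]

end PiKronecker

section Separable

variable {N : ℕ} {ι : Type*}

theorem productMatrix_apply (A : Fin N → Matrix ι ι ℂ) (x y : Fin N → ι) :
    productMatrix A x y = ∏ k, A k (x k) (y k) := rfl

theorem conjTranspose_productMatrix (A : Fin N → Matrix ι ι ℂ) :
    (productMatrix A)ᴴ = productMatrix fun k => (A k)ᴴ :=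
  conjTranspose_piKronecker A

variable [Fintype ι]

theorem productVector_apply (a : Fin N → EuclideanSpace ℂ ι) (x : Fin N → ι) :
    productVector a x = ∏ k, a k (x k) := rfl

theorem productMatrix_mul (A B : Fin N → Matrix ι ι ℂ) :
    productMatrix A * productMatrix B = productMatrix fun k => A k * B k :=
  piKronecker_mul A B

theorem trace_productMatrix (A : Fin N → Matrix ι ι ℂ) :
    (productMatrix A).trace = ∏ k, (A k).trace :=
  trace_piKronecker A

theorem productMatrix_sum_smul (p : Fin N → ι → ℝ) (B : Fin N → ι → Matrix ι ι ℂ) :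
    productMatrix (fun k => ∑ i, p k i • B k i) =
      ∑ f : Fin N → ι, (∏ k, p k (f k)) • productMatrix fun k => B k (f k) := by
  ext x y
  simp only [productMatrix_apply, Matrix.sum_apply, Matrix.smul_apply, Complex.real_smul,
    prod_univ_sum_univ, Finset.prod_mul_distrib, Complex.ofReal_prod]

/-- The rank-one operator `|φ⟩⟨φ|`. -/
def ketbra (φ : EuclideanSpace ℂ ι) : Matrix ι ι ℂ :=
  vecMulVec φ.ofLp (star φ.ofLp)

theorem ketbra_productVector (a : Fin N → EuclideanSpace ℂ ι) :
    ketbra (productVector a) = productMatrix fun k => ketbra (a k) := by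
  ext x y
  simp only [ketbra, vecMulVec_apply, Pi.star_apply, productMatrix_apply, productVector_apply,
    star_prod, Finset.prod_mul_distrib]

theorem trace_ketbra (φ : EuclideanSpace ℂ ι) : (ketbra φ).trace = ((‖φ‖ ^ 2 : ℝ) : ℂ) := by
  rw [ketbra, trace_vecMulVec, ← EuclideanSpace.inner_eq_star_dotProduct,
    inner_self_eq_norm_sq_to_K, Complex.ofReal_pow]
  rfl

theorem trace_mul_ketbra (ρ : Matrix ι ι ℂ) (φ : EuclideanSpace ℂ ι) :
    (ρ * ketbra φ).trace.re = expectation ρ φ := by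
  rw [expectation, ketbra, mul_vecMulVec, trace_vecMulVec, dotProduct_comm]

theorem isState_ketbra {φ : EuclideanSpace ℂ ι} (hφ : ‖φ‖ = 1) : IsState (ketbra φ) :=
  ⟨posSemidef_vecMulVec_self_star _, by rw [trace_ketbra, hφ, one_pow, Complex.ofReal_one]⟩

theorem IsState.nonempty {ρ : Matrix ι ι ℂ} (hρ : IsState ρ) : Nonempty ι := by
  by_contra hempty
  rw [not_nonempty_iff] at hempty
  exact zero_ne_one (hρ.2 ▸ (trace_eq_zero_of_isEmpty ρ).symm)

theorem convex_setOf_isState : Convex ℝ {σ : Matrix ι ι ℂ | IsState σ} := by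
  intro σ hσ τ hτ a b ha hb hab
  refine ⟨(hσ.1.smul ha).add (hτ.1.smul hb), ?_⟩
  rw [trace_add, trace_smul, trace_smul, hσ.2, hτ.2, ← add_smul, hab, one_smul]

theorem IsState.conj_unitary {A U : Matrix ι ι ℂ} [DecidableEq ι] (hA : IsState A)
    (hU : U ∈ unitaryGroup ι ℂ) : IsState (U * A * Uᴴ) := by
  refine ⟨hA.1.mul_mul_conjTranspose_same U, ?_⟩
  rw [trace_mul_comm, ← Matrix.mul_assoc, ← star_eq_conjTranspose, Unitary.star_mul_self_of_mem hU,
    Matrix.one_mul, hA.2]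

theorem cfc_eq_sum_smul_ketbra [DecidableEq ι] {A : Matrix ι ι ℂ} (hA : A.IsHermitian)
    (f : ℝ → ℝ) :
    cfc f A = ∑ i, f (hA.eigenvalues i) • ketbra (hA.eigenvectorBasis i) := by
  ext x y
  rw [hA.cfc_eq, IsHermitian.cfc, Unitary.conjStarAlgAut_apply, Matrix.mul_apply, Matrix.sum_apply]
  refine Finset.sum_congr rfl fun i _ => ?_
  rw [mul_diagonal, star_apply, IsHermitian.eigenvectorUnitary_apply,
    IsHermitian.eigenvectorUnitary_apply, Matrix.smul_apply, ketbra, vecMulVec_apply,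
    Complex.real_smul, mul_left_comm, ← mul_assoc]
  rfl

theorem IsState.exists_eq_sum_smul_ketbra {A : Matrix ι ι ℂ} (hA : IsState A) :
    ∃ (p : ι → ℝ) (v : ι → EuclideanSpace ℂ ι), (∀ i, 0 ≤ p i) ∧ ∑ i, p i = 1 ∧
      (∀ i, ‖v i‖ = 1) ∧ A = ∑ i, p i • ketbra (v i) := by
  classical
  have hH := hA.1.isHermitian
  refine ⟨hH.eigenvalues, hH.eigenvectorBasis, hA.1.eigenvalues_nonneg, ?_,
    hH.eigenvectorBasis.orthonormal.1, ?_⟩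
  · have htr := hA.2
    rw [hH.trace_eq_sum_eigenvalues] at htr
    exact Complex.ofReal_injective (by push_cast; exact htr)
  · exact (cfc_id ℝ A hH.isSelfAdjoint).symm.trans (cfc_eq_sum_smul_ketbra hH id)

open scoped MatrixOrder in
theorem posSemidef_productMatrix {ι : Type*} [Finite ι] {A : Fin N → Matrix ι ι ℂ}
    (hA : ∀ k, (A k).PosSemidef) : (productMatrix A).PosSemidef := by
  classical
  have := Fintype.ofFinite ι
  choose B hB using fun k => CStarAlgebra.nonneg_iff_eq_star_mul_self.mp (hA k).nonneg
  have hfactor : productMatrix A = (productMatrix B)ᴴ * productMatrix B := by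
    rw [conjTranspose_productMatrix, productMatrix_mul, funext hB]
    rfl
  rw [hfactor]
  exact posSemidef_conjTranspose_mul_self _

theorem isState_productMatrix {A : Fin N → Matrix ι ι ℂ} (hA : ∀ k, IsState (A k)) :
    IsState (productMatrix A) :=
  ⟨posSemidef_productMatrix fun k => (hA k).1, by
    rw [trace_productMatrix, Finset.prod_eq_one fun k _ => (hA k).2]⟩

theorem isState_of_mem_separableStates {σ : Matrix (Fin N → ι) (Fin N → ι) ℂ}
    (hσ : σ ∈ separableStates N ι) : IsState σ := by
  refine convexHull_min ?_ convex_setOf_isState hσ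
  rintro _ ⟨A, hA, rfl⟩
  exact isState_productMatrix hA

theorem conj_productMatrix_mem_separableStates [DecidableEq ι] {U : Fin N → Matrix ι ι ℂ}
    (hU : ∀ k, U k ∈ unitaryGroup ι ℂ) {σ : Matrix (Fin N → ι) (Fin N → ι) ℂ}
    (hσ : σ ∈ separableStates N ι) :
    productMatrix U * σ * (productMatrix U)ᴴ ∈ separableStates N ι := by
  have hconvex : Convex ℝ {σ : Matrix (Fin N → ι) (Fin N → ι) ℂ |
      productMatrix U * σ * (productMatrix U)ᴴ ∈ separableStates N ι} := by
    intro σ hσ τ hτ a b ha hb hab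
    simp only [Set.mem_ofPred_eq, Matrix.mul_add, Matrix.add_mul, Matrix.mul_smul,
      Matrix.smul_mul]
    exact convex_convexHull ℝ _ hσ hτ ha hb hab
  refine convexHull_min ?_ hconvex hσ
  rintro _ ⟨A, hA, rfl⟩
  refine subset_convexHull ℝ _ ⟨_, fun k => (hA k).conj_unitary (hU k), ?_⟩
  rw [conjTranspose_productMatrix, productMatrix_mul, productMatrix_mul]

theorem separableStates_eq_convexHull_ketbra (N : ℕ) (ι : Type*) [Fintype ι] :
    separableStates N ι = convexHull ℝ (ketbra '' productStates N ι) := by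
  refine Set.Subset.antisymm (convexHull_min ?_ (convex_convexHull ℝ _)) (convexHull_mono ?_)
  · rintro _ ⟨A, hA, rfl⟩
    choose p v hp hp1 hv hA using fun k => (hA k).exists_eq_sum_smul_ketbra
    rw [funext hA, productMatrix_sum_smul]
    refine (convex_convexHull ℝ _).sum_mem (fun f _ => Finset.prod_nonneg fun k _ => hp k _) ?_
      fun f _ => subset_convexHull ℝ _
        ⟨_, ⟨fun k => v k (f k), fun k => hv k _, rfl⟩, ketbra_productVector _⟩
    rw [← prod_univ_sum_univ, Finset.prod_eq_one fun k _ => hp1 k]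
  · rintro _ ⟨_, ⟨a, ha, rfl⟩, rfl⟩
    exact ⟨_, fun k => isState_ketbra (ha k), ketbra_productVector a⟩

theorem ketbra_mem_separableStates {φ : EuclideanSpace ℂ (Fin N → ι)}
    (hφ : φ ∈ productStates N ι) : ketbra φ ∈ separableStates N ι := by
  rw [separableStates_eq_convexHull_ketbra]
  exact subset_convexHull ℝ _ (Set.mem_image_of_mem _ hφ)

theorem productVector_single [DecidableEq ι] (x : Fin N → ι) :
    productVector (fun k => EuclideanSpace.single (x k) (1 : ℂ)) = EuclideanSpace.single x 1 := by
  ext y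
  simp only [productVector_apply, PiLp.single_apply, Finset.prod_ite_zero, Finset.prod_const_one,
    Finset.mem_univ, forall_const, funext_iff]

theorem single_mem_productStates [DecidableEq ι] (x : Fin N → ι) :
    EuclideanSpace.single x (1 : ℂ) ∈ productStates N ι :=
  ⟨fun k => EuclideanSpace.single (x k) 1, fun k => by simp, (productVector_single x).symm⟩

theorem expectation_single [DecidableEq ι] (ρ : Matrix ι ι ℂ) (x : ι) :
    expectation ρ (EuclideanSpace.single x 1) = (ρ x x).re := by
  simp [expectation]

theorem isCompact_productStates (N : ℕ) (ι : Type*) [Fintype ι] :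
    IsCompact (productStates N ι) := by
  have hcompact := isCompact_univ_pi fun _ : Fin N =>
    isCompact_sphere (0 : EuclideanSpace ℂ ι) 1
  have hcont : Continuous (productVector : (Fin N → EuclideanSpace ℂ ι) → _) := by
    unfold productVector
    fun_prop
  convert hcompact.image hcont using 1
  ext φ
  simp [productStates, eq_comm]

theorem continuous_expectation (ρ : Matrix ι ι ℂ) : Continuous (expectation ρ) := by
  unfold expectation
  fun_prop

theorem expectation_real_smul (c : ℝ) (ρ : Matrix ι ι ℂ) (φ : EuclideanSpace ℂ ι) :
    expectation (c • ρ) φ = c * expectation ρ φ := by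
  rw [expectation, smul_mulVec, dotProduct_smul, Complex.smul_re, smul_eq_mul, expectation]

theorem expectation_nonneg {ρ : Matrix ι ι ℂ} (hρ : ρ.PosSemidef) (φ : EuclideanSpace ℂ ι) :
    0 ≤ expectation ρ φ :=
  (Complex.nonneg_iff.mp (hρ.dotProduct_mulVec_nonneg φ.ofLp)).1

theorem ofReal_expectation {ρ : Matrix ι ι ℂ} (hρ : ρ.PosSemidef) (φ : EuclideanSpace ℂ ι) :
    (expectation ρ φ : ℂ) = (ρ * ketbra φ).trace := by
  rw [ketbra, mul_vecMulVec, trace_vecMulVec, dotProduct_comm]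
  exact Complex.ext rfl (Complex.nonneg_iff.mp (hρ.dotProduct_mulVec_nonneg φ.ofLp)).2

end Separable

section MaxOverlap

variable {N : ℕ} {ι : Type*} [Fintype ι] (ρ : Matrix (Fin N → ι) (Fin N → ι) ℂ)

theorem trace_mul_re_le_of_forall_expectation_le {c : ℝ}
    (hc : ∀ φ ∈ productStates N ι, expectation ρ φ ≤ c) {σ : Matrix (Fin N → ι) (Fin N → ι) ℂ}
    (hσ : σ ∈ separableStates N ι) : (ρ * σ).trace.re ≤ c := by
  rw [separableStates_eq_convexHull_ketbra] at hσ
  have hconvex : Convex ℝ {σ : Matrix (Fin N → ι) (Fin N → ι) ℂ | (ρ * σ).trace.re ≤ c} := by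
    refine convex_halfSpace_le ⟨fun σ τ => ?_, fun t σ => ?_⟩ c
    · rw [Matrix.mul_add, trace_add, Complex.add_re]
    · rw [mul_smul_comm, trace_smul, Complex.smul_re]
  refine convexHull_min ?_ hconvex hσ
  rintro _ ⟨φ, hφ, rfl⟩
  exact (trace_mul_ketbra ρ φ).trans_le (hc φ hφ)

variable {ρ}

theorem maxOverlapSq_eq_of_forall_expectation_le {φ : EuclideanSpace ℂ (Fin N → ι)}
    (hφ : φ ∈ productStates N ι)
    (hmax : ∀ χ ∈ productStates N ι, expectation ρ χ ≤ expectation ρ φ) :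
    maxOverlapSq ρ = expectation ρ φ := by
  refine IsGreatest.csSup_eq ⟨⟨_, ketbra_mem_separableStates hφ, trace_mul_ketbra ρ φ⟩, ?_⟩
  rintro _ ⟨σ, hσ, rfl⟩
  exact trace_mul_re_le_of_forall_expectation_le ρ hmax hσ

variable (ρ)

theorem exists_isClosestProductState [Nonempty (Fin N → ι)] : ∃ φ, IsClosestProductState ρ φ := by
  classical
  obtain ⟨φ, hφ, hmax⟩ := (isCompact_productStates N ι).exists_isMaxOn
    ⟨_, single_mem_productStates (Classical.arbitrary _)⟩
    (continuous_expectation ρ).continuousOn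
  exact ⟨φ, hφ, (maxOverlapSq_eq_of_forall_expectation_le hφ hmax).symm⟩

theorem expectation_le_maxOverlapSq {φ : EuclideanSpace ℂ (Fin N → ι)}
    (hφ : φ ∈ productStates N ι) : expectation ρ φ ≤ maxOverlapSq ρ := by
  classical
  obtain ⟨χ, hχ, hmax⟩ := (isCompact_productStates N ι).exists_isMaxOn ⟨φ, hφ⟩
    (continuous_expectation ρ).continuousOn
  exact (hmax hφ).trans_eq (maxOverlapSq_eq_of_forall_expectation_le hχ hmax).symm

theorem trace_mul_re_le_maxOverlapSq {σ : Matrix (Fin N → ι) (Fin N → ι) ℂ}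
    (hσ : σ ∈ separableStates N ι) : (ρ * σ).trace.re ≤ maxOverlapSq ρ :=
  trace_mul_re_le_of_forall_expectation_le ρ (fun _ => expectation_le_maxOverlapSq ρ) hσ

variable {ρ}

theorem maxOverlapSq_pos (hρ : IsState ρ) : 0 < maxOverlapSq ρ := by
  classical
  have htr : (∑ x, (ρ x x).re) = 1 := by
    rw [← Complex.re_sum, ← Complex.one_re, ← hρ.2]
    rfl
  obtain ⟨x, -, hx⟩ := Finset.exists_lt_of_sum_lt (f := fun _ => (0 : ℝ)) (s := Finset.univ)
    (g := fun x => (ρ x x).re) (by rw [htr, Finset.sum_const_zero]; exact one_pos)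
  exact hx.trans_le ((expectation_single ρ x).symm.trans_le
    (expectation_le_maxOverlapSq ρ (single_mem_productStates x)))

theorem geometricMeasure_eq_neg_logb (hρ : IsState ρ) :
    geometricMeasure ρ = -Real.logb 2 (maxOverlapSq ρ) := by
  rw [geometricMeasure, Real.logb, Real.log_sqrt (maxOverlapSq_pos hρ).le, Real.logb]
  ring

end MaxOverlap

section FunctionalCalculus

theorem sum_mul_logb_le_logb {α : Type*} [Fintype α] {p x : α → ℝ} {b : ℝ}
    (hp : ∀ i, 0 ≤ p i) (hp1 : ∑ i, p i = 1) (hx : ∀ i, 0 ≤ x i)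
    (hzero : ∀ i, x i = 0 → p i = 0) (hb : 0 < b) (hle : ∑ i, p i * x i ≤ b) :
    ∑ i, p i * Real.logb 2 (x i) ≤ Real.logb 2 b := by
  have htangent (i : α) : p i * Real.log (x i) ≤ p i * (Real.log b - 1) + p i * x i / b := by
    rcases (hx i).eq_or_lt with h0 | h0
    · simp [hzero i h0.symm]
    · have hlog := Real.log_le_sub_one_of_pos (div_pos h0 hb)
      rw [Real.log_div h0.ne' hb.ne'] at hlog
      rw [mul_div_assoc, ← mul_add]
      exact mul_le_mul_of_nonneg_left (by linarith) (hp i)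
  have hlog : ∑ i, p i * Real.log (x i) ≤ Real.log b := by
    calc ∑ i, p i * Real.log (x i)
        ≤ ∑ i, (p i * (Real.log b - 1) + p i * x i / b) :=
          Finset.sum_le_sum fun i _ => htangent i
      _ = Real.log b - 1 + (∑ i, p i * x i) / b := by
          rw [Finset.sum_add_distrib, ← Finset.sum_mul, hp1, one_mul, ← Finset.sum_div]
      _ ≤ Real.log b := by linarith [(div_le_one hb).mpr hle]
  simp only [Real.logb, ← mul_div_assoc, ← Finset.sum_div]
  exact div_le_div_of_nonneg_right hlog (Real.log_pos one_lt_two).le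

variable {α : Type*} [Fintype α] [DecidableEq α]

theorem cfc_mul_of_mul_eq_smul {A B : Matrix α α ℂ} {c : ℝ} (hA : A.IsHermitian)
    (hAB : A * B = c • B) (f : ℝ → ℝ) : cfc f A * B = f c • B := by
  have heigen (i : α) : f (hA.eigenvalues i) • (ketbra (hA.eigenvectorBasis i) * B) =
      f c • (ketbra (hA.eigenvectorBasis i) * B) := by
    have hleft : ketbra (hA.eigenvectorBasis i) * A =
        hA.eigenvalues i • ketbra (hA.eigenvectorBasis i) := by
      have hstar := star_mulVec A (hA.eigenvectorBasis i).ofLp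
      rw [hA.eq] at hstar
      rw [ketbra, vecMulVec_mul, ← hstar, hA.mulVec_eigenvectorBasis, star_smul, star_trivial,
        vecMulVec_smul]
    have hsmul : (hA.eigenvalues i - c) • (ketbra (hA.eigenvectorBasis i) * B) = 0 := by
      rw [sub_smul, ← Matrix.smul_mul, ← hleft, Matrix.mul_assoc, hAB, Matrix.mul_smul, sub_self]
    rcases smul_eq_zero.mp hsmul with h | h
    · rw [sub_eq_zero.mp h]
    · rw [h, smul_zero, smul_zero]
  have hone : ∑ i, ketbra (hA.eigenvectorBasis i) = 1 := by
    have h := cfc_eq_sum_smul_ketbra hA fun _ => 1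
    rw [cfc_const_one ℝ A hA.isSelfAdjoint] at h
    simpa only [one_smul] using h.symm
  rw [cfc_eq_sum_smul_ketbra hA, Matrix.sum_mul]
  simp only [Matrix.smul_mul, heigen]
  rw [← Finset.smul_sum, ← Matrix.sum_mul, hone, Matrix.one_mul]

theorem trace_mul_cfc_re (ρ : Matrix α α ℂ) {σ : Matrix α α ℂ} (hσ : σ.IsHermitian) (f : ℝ → ℝ) :
    (ρ * cfc f σ).trace.re =
      ∑ i, expectation ρ (hσ.eigenvectorBasis i) * f (hσ.eigenvalues i) := by
  rw [cfc_eq_sum_smul_ketbra hσ, Matrix.mul_sum, trace_sum, Complex.re_sum]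
  refine Finset.sum_congr rfl fun i _ => ?_
  rw [Matrix.mul_smul, trace_smul, Complex.smul_re, trace_mul_ketbra, smul_eq_mul, mul_comm]

theorem trace_mul_matrixLog_re_le {ρ σ : Matrix α α ℂ} (hρ : IsState ρ) (hσ : σ.PosSemidef)
    (hker : ∀ v : α → ℂ, σ *ᵥ v = 0 → ρ *ᵥ v = 0) {b : ℝ} (hb : 0 < b)
    (h : (ρ * σ).trace.re ≤ b) : (ρ * matrixLog σ).trace.re ≤ Real.logb 2 b := by
  have hH := hσ.isHermitian
  rw [matrixLog, trace_mul_cfc_re ρ hH]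
  refine sum_mul_logb_le_logb (fun i => expectation_nonneg hρ.1 _) ?_ hσ.eigenvalues_nonneg ?_
    hb ?_
  · have hone := trace_mul_cfc_re ρ hH fun _ => 1
    rw [cfc_const_one ℝ σ hH.isSelfAdjoint, Matrix.mul_one, hρ.2] at hone
    simpa only [mul_one, Complex.one_re] using hone.symm
  · intro i hi
    have hker_i := hker _ (by rw [hH.mulVec_eigenvectorBasis, hi, zero_smul])
    rw [expectation, hker_i, dotProduct_zero, Complex.zero_re]
  · refine (trace_mul_cfc_re ρ hH id).symm.trans_le ?_
    rwa [cfc_id ℝ σ hH.isSelfAdjoint]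

end FunctionalCalculus

section ProjectorState

variable {α : Type*} [Fintype α]

/-- The normalized projector `Q / tr Q`. -/
def projectorState (Q : Matrix α α ℂ) : Matrix α α ℂ :=
  Q.trace⁻¹ • Q

variable {Q : Matrix α α ℂ}

theorem posSemidef_of_isStarProjection (hQ : IsStarProjection Q) : Q.PosSemidef := by
  have hpos := posSemidef_conjTranspose_mul_self Q
  rwa [← star_eq_conjTranspose, hQ.isSelfAdjoint.star_eq, hQ.isIdempotentElem.eq] at hpos

theorem ofReal_trace_re_of_isStarProjection (hQ : IsStarProjection Q) :
    ((Q.trace.re : ℝ) : ℂ) = Q.trace :=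
  Complex.ext rfl (Complex.nonneg_iff.mp (posSemidef_of_isStarProjection hQ).trace_nonneg).2

theorem trace_re_pos_of_isStarProjection (hQ : IsStarProjection Q) (hQ0 : Q ≠ 0) :
    0 < Q.trace.re := by
  have hpos := posSemidef_of_isStarProjection hQ
  refine (Complex.nonneg_iff.mp hpos.trace_nonneg).1.lt_of_ne' fun h => hQ0 ?_
  rw [← hpos.trace_eq_zero_iff, ← ofReal_trace_re_of_isStarProjection hQ, h, Complex.ofReal_zero]

theorem projectorState_eq_real_smul (hQ : IsStarProjection Q) :
    projectorState Q = Q.trace.re⁻¹ • Q := by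
  rw [projectorState, ← Complex.coe_smul, Complex.ofReal_inv,
    ofReal_trace_re_of_isStarProjection hQ]

theorem isState_projectorState (hQ : IsStarProjection Q) (hQ0 : Q ≠ 0) :
    IsState (projectorState Q) := by
  have ht := trace_re_pos_of_isStarProjection hQ hQ0
  constructor
  · rw [projectorState_eq_real_smul hQ]
    exact (posSemidef_of_isStarProjection hQ).smul (inv_nonneg.mpr ht.le)
  · rw [projectorState, trace_smul, smul_eq_mul, inv_mul_cancel₀]
    rw [← ofReal_trace_re_of_isStarProjection hQ]
    exact_mod_cast ht.ne'

theorem trace_projectorState_mul_re (hQ : IsStarProjection Q) (X : Matrix α α ℂ) :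
    (projectorState Q * X).trace.re = Q.trace.re⁻¹ * (Q * X).trace.re := by
  rw [projectorState_eq_real_smul hQ, Matrix.smul_mul, trace_smul, Complex.smul_re, smul_eq_mul]

theorem projectorState_mul_self (hQ : IsStarProjection Q) :
    projectorState Q * Q = Q.trace.re⁻¹ • Q := by
  rw [projectorState_eq_real_smul hQ, Matrix.smul_mul, hQ.isIdempotentElem.eq]

theorem mul_comm_of_mul_eq_smul (hQ : IsStarProjection Q) {σ : Matrix α α ℂ}
    (hσ : σ.IsHermitian) {c : ℝ} (h : σ * Q = c • Q) : Q * σ = c • Q := by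
  have hstar := congrArg star h
  rwa [star_mul, hQ.isSelfAdjoint.star_eq, star_eq_conjTranspose, hσ.eq, star_smul, star_trivial,
    hQ.isSelfAdjoint.star_eq] at hstar

theorem posSemidef_sub_smul_of_mul_eq_smul (hQ : IsStarProjection Q) {σ : Matrix α α ℂ}
    (hσ : σ.PosSemidef) {c : ℝ} (h : σ * Q = c • Q) : (σ - c • Q).PosSemidef := by
  classical
  have hcompress : σ - c • Q = (1 - Q)ᴴ * σ * (1 - Q) := by
    rw [← star_eq_conjTranspose, hQ.one_sub.isSelfAdjoint.star_eq, sub_mul, mul_sub, one_mul,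
      mul_comm_of_mul_eq_smul hQ hσ.isHermitian h, mul_one, sub_mul, h, Matrix.smul_mul,
      hQ.isIdempotentElem.eq, sub_self, sub_zero]
  rw [hcompress]
  exact hσ.conjTranspose_mul_mul_same _

theorem trace_mul_re_le_one_of_isStarProjection (hQ : IsStarProjection Q) {σ : Matrix α α ℂ}
    (hσ : IsState σ) : (Q * σ).trace.re ≤ 1 := by
  classical
  have hP := hQ.one_sub
  have hnonneg := (hσ.1.conjTranspose_mul_mul_same (1 - Q)).trace_nonneg
  rw [← star_eq_conjTranspose, hP.isSelfAdjoint.star_eq, trace_mul_comm, ← Matrix.mul_assoc,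
    hP.isIdempotentElem.eq, sub_mul, one_mul, trace_sub, hσ.2] at hnonneg
  simpa using (Complex.nonneg_iff.mp hnonneg).1

variable [DecidableEq α]

theorem trace_projectorState_mul_matrixLog_re (hQ : IsStarProjection Q) (hQ0 : Q ≠ 0)
    {σ : Matrix α α ℂ} (hσ : σ.IsHermitian) {c : ℝ} (h : σ * Q = c • Q) :
    (projectorState Q * matrixLog σ).trace.re = Real.logb 2 c := by
  rw [trace_projectorState_mul_re hQ, trace_mul_comm, matrixLog, cfc_mul_of_mul_eq_smul hσ h,
    trace_smul, Complex.smul_re, smul_eq_mul, mul_left_comm,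
    inv_mul_cancel₀ (trace_re_pos_of_isStarProjection hQ hQ0).ne', mul_one]

theorem trace_projectorState_mul_matrixLog_self_re (hQ : IsStarProjection Q) (hQ0 : Q ≠ 0) :
    (projectorState Q * matrixLog (projectorState Q)).trace.re = -Real.logb 2 Q.trace.re := by
  rw [trace_projectorState_mul_matrixLog_re hQ hQ0 (isState_projectorState hQ hQ0).1.isHermitian
    (projectorState_mul_self hQ), Real.logb_inv]

theorem relativeEntropy_projectorState (hQ : IsStarProjection Q) (hQ0 : Q ≠ 0)
    {σ : Matrix α α ℂ} (hσ : σ.IsHermitian) {c : ℝ} (hc : c ≠ 0) (h : σ * Q = c • Q) :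
    relativeEntropy (projectorState Q) σ =
      ((-Real.logb 2 Q.trace.re - Real.logb 2 c : ℝ) : EReal) := by
  have hker (v : α → ℂ) (hv : σ *ᵥ v = 0) : projectorState Q *ᵥ v = 0 := by
    have hQv : c • Q *ᵥ v = 0 := by
      rw [← smul_mulVec, ← mul_comm_of_mul_eq_smul hQ hσ h, ← mulVec_mulVec, hv, mulVec_zero]
    rw [projectorState, smul_mulVec, (smul_eq_zero.mp hQv).resolve_left hc, smul_zero]
  rw [relativeEntropy, if_pos hker, mul_sub, trace_sub, Complex.sub_re,
    trace_projectorState_mul_matrixLog_self_re hQ hQ0,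
    trace_projectorState_mul_matrixLog_re hQ hQ0 hσ h]

theorem le_relativeEntropy_projectorState (hQ : IsStarProjection Q) (hQ0 : Q ≠ 0)
    {σ : Matrix α α ℂ} (hσ : σ.PosSemidef) {b : ℝ} (hb : 0 < b)
    (h : (projectorState Q * σ).trace.re ≤ b) :
    ((-Real.logb 2 Q.trace.re - Real.logb 2 b : ℝ) : EReal) ≤
      relativeEntropy (projectorState Q) σ := by
  rw [relativeEntropy]
  split_ifs with hker
  · rw [mul_sub, trace_sub, Complex.sub_re, trace_projectorState_mul_matrixLog_self_re hQ hQ0,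
      EReal.coe_le_coe_iff]
    exact sub_le_sub_left
      (trace_mul_matrixLog_re_le (isState_projectorState hQ hQ0) hσ hker hb h) _
  · exact le_top

end ProjectorState

section Collapse

variable {N : ℕ} {ι : Type*} [Fintype ι]

theorem exists_isState_mixture_mem_separableStates {ρ σ : Matrix (Fin N → ι) (Fin N → ι) ℂ}
    (hρ : IsState ρ) (hσ : σ ∈ separableStates N ι) {s : ℝ} (hs : 0 ≤ s)
    (hpos : ((1 + s) • σ - ρ).PosSemidef) :
    ∃ Δ : Matrix (Fin N → ι) (Fin N → ι) ℂ, IsState Δ ∧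
      (1 + s)⁻¹ • (ρ + s • Δ) ∈ separableStates N ι := by
  have hσs := isState_of_mem_separableStates hσ
  have htrace : ((1 + s) • σ - ρ).trace = s := by
    rw [trace_sub, trace_smul, hσs.2, hρ.2, Complex.real_smul]
    push_cast
    ring
  rcases hs.eq_or_lt with rfl | hs
  · rw [Complex.ofReal_zero, hpos.trace_eq_zero_iff, add_zero, one_smul, sub_eq_zero] at htrace
    exact ⟨ρ, hρ, by rwa [zero_smul, add_zero, add_zero, inv_one, one_smul, ← htrace]⟩
  · refine ⟨s⁻¹ • ((1 + s) • σ - ρ), ⟨hpos.smul (inv_nonneg.mpr hs.le), ?_⟩, ?_⟩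
    · rw [trace_smul, htrace, Complex.real_smul, ← Complex.ofReal_mul, inv_mul_cancel₀ hs.ne',
        Complex.ofReal_one]
    · rwa [smul_inv_smul₀ hs.ne', add_sub_cancel, inv_smul_smul₀ (by positivity)]

variable {Q : Matrix (Fin N → ι) (Fin N → ι) ℂ}

theorem one_le_one_add_mul_of_mem_separableStates (hQ : IsStarProjection Q)
    (hQ0 : Q ≠ 0) {Δ : Matrix (Fin N → ι) (Fin N → ι) ℂ} (hΔ : Δ.PosSemidef) {s : ℝ} (hs : 0 ≤ s)
    (hsep : (1 + s)⁻¹ • (projectorState Q + s • Δ) ∈ separableStates N ι) :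
    1 ≤ (1 + s) * (Q.trace.re * maxOverlapSq (projectorState Q)) := by
  have ht := trace_re_pos_of_isStarProjection hQ hQ0
  have hoverlap := trace_mul_re_le_maxOverlapSq (projectorState Q) hsep
  have hΔ0 : 0 ≤ (Q * Δ).trace.re := by
    have hnonneg := (hΔ.conjTranspose_mul_mul_same Q).trace_nonneg
    rw [← star_eq_conjTranspose, hQ.isSelfAdjoint.star_eq, trace_mul_comm, ← Matrix.mul_assoc,
      hQ.isIdempotentElem.eq] at hnonneg
    exact (Complex.nonneg_iff.mp hnonneg).1
  have hone : (Q * projectorState Q).trace.re = 1 := by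
    rw [trace_mul_comm, projectorState_mul_self hQ, trace_smul, Complex.smul_re, smul_eq_mul,
      inv_mul_cancel₀ ht.ne']
  rw [trace_projectorState_mul_re hQ, mul_smul_comm, trace_smul, Complex.smul_re, smul_eq_mul,
    mul_add, trace_add, Complex.add_re, hone, mul_smul_comm, trace_smul, Complex.smul_re,
    smul_eq_mul, inv_mul_le_iff₀ ht, inv_mul_le_iff₀ (by positivity)] at hoverlap
  linarith [mul_nonneg hs hΔ0]

theorem globalRobustness_projectorState (hQ : IsStarProjection Q) (hQ0 : Q ≠ 0)
    {σ : Matrix (Fin N → ι) (Fin N → ι) ℂ} (hσ : σ ∈ separableStates N ι)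
    (h : σ * Q = maxOverlapSq (projectorState Q) • Q) :
    globalRobustness (projectorState Q) =
      (Q.trace.re * maxOverlapSq (projectorState Q))⁻¹ - 1 := by
  have hρ := isState_projectorState hQ hQ0
  have ht := trace_re_pos_of_isStarProjection hQ hQ0
  have hσs := isState_of_mem_separableStates hσ
  set b := maxOverlapSq (projectorState Q)
  have htb : 0 < Q.trace.re * b := mul_pos ht (maxOverlapSq_pos hρ)
  have htb1 : Q.trace.re * b ≤ 1 := by
    have hle := trace_mul_re_le_one_of_isStarProjection hQ hσs
    rwa [trace_mul_comm, h, trace_smul, Complex.smul_re, smul_eq_mul, mul_comm] at hle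
  have hs : 0 ≤ (Q.trace.re * b)⁻¹ - 1 := sub_nonneg.mpr ((one_le_inv₀ htb).mpr htb1)
  refine IsLeast.csInf_eq ⟨⟨hs, ?_⟩, ?_⟩
  · refine exists_isState_mixture_mem_separableStates hρ hσ hs ?_
    have hfactor : (1 + ((Q.trace.re * b)⁻¹ - 1)) • σ - projectorState Q =
        (Q.trace.re * b)⁻¹ • (σ - b • Q) := by
      rw [add_sub_cancel, smul_sub, smul_smul, projectorState_eq_real_smul hQ, mul_inv,
        inv_mul_cancel_right₀ (maxOverlapSq_pos hρ).ne']
    rw [hfactor]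
    exact (posSemidef_sub_smul_of_mul_eq_smul hQ hσs.1 h).smul (inv_nonneg.mpr htb.le)
  · rintro r ⟨hr, Δ, hΔ, hsep⟩
    have hle := one_le_one_add_mul_of_mem_separableStates hQ hQ0 hΔ.1 hr hsep
    rwa [sub_le_iff_le_add', inv_le_iff_one_le_mul₀ htb]

theorem logGlobalRobustness_projectorState (hQ : IsStarProjection Q) (hQ0 : Q ≠ 0)
    {σ : Matrix (Fin N → ι) (Fin N → ι) ℂ} (hσ : σ ∈ separableStates N ι)
    (h : σ * Q = maxOverlapSq (projectorState Q) • Q) :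
    logGlobalRobustness (projectorState Q) =
      geometricMeasure (projectorState Q) - Real.logb 2 Q.trace.re := by
  have hρ := isState_projectorState hQ hQ0
  rw [logGlobalRobustness, globalRobustness_projectorState hQ hQ0 hσ h, add_sub_cancel,
    Real.logb_inv, Real.logb_mul (trace_re_pos_of_isStarProjection hQ hQ0).ne'
      (maxOverlapSq_pos hρ).ne', geometricMeasure_eq_neg_logb hρ]
  ring

theorem relativeEntropyOfEntanglement_projectorState [DecidableEq ι] (hQ : IsStarProjection Q)
    (hQ0 : Q ≠ 0) {σ : Matrix (Fin N → ι) (Fin N → ι) ℂ} (hσ : σ ∈ separableStates N ι)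
    (h : σ * Q = maxOverlapSq (projectorState Q) • Q) :
    relativeEntropyOfEntanglement (projectorState Q) =
      ((geometricMeasure (projectorState Q) - Real.logb 2 Q.trace.re : ℝ) : EReal) := by
  have hρ := isState_projectorState hQ hQ0
  have hb := maxOverlapSq_pos hρ
  rw [geometricMeasure_eq_neg_logb hρ, neg_sub_comm]
  refine le_antisymm ?_ (le_iInf₂ fun τ hτ => ?_)
  · exact (iInf₂_le σ hσ).trans_eq (relativeEntropy_projectorState hQ hQ0
      (isState_of_mem_separableStates hσ).1.isHermitian hb.ne' h)
  · exact le_relativeEntropy_projectorState hQ hQ0 (isState_of_mem_separableStates hτ).1 hb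
      (trace_mul_re_le_maxOverlapSq _ hτ)

end Collapse

section Antisymmetrizer

variable {ι : Type*}

theorem eq_zero_of_antisymmetric {n : ℕ} {f : (Fin n → ι) → ℂ}
    (hf : ∀ (π : Equiv.Perm (Fin n)) x, f (x ∘ π) = ((Equiv.Perm.sign π : ℤ) : ℂ) * f x)
    {x : Fin n → ι} (hx : ¬ Function.Injective x) : f x = 0 := by
  obtain ⟨i, j, hij, hne⟩ := Function.not_injective_iff.mp hx
  have hswap : x ∘ Equiv.swap i j = x := by
    rw [Equiv.comp_swap_eq_update, hij, Function.update_eq_self, ← hij, Function.update_eq_self]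
  have hneg := hf (Equiv.swap i j) x
  rw [hswap, Equiv.Perm.sign_swap hne] at hneg
  exact self_eq_neg.mp (by simpa using hneg)

variable [DecidableEq ι]

/-- The orthogonal projection onto the antisymmetric functions of `n` variables in `ι`. Its entry
at `x`, `y` is `(1/n!) ∑ π, sign π [x ∘ π = y]`, encoded as the determinant of the matrix of the
Kronecker deltas of `x k` and `y l`. -/
def antisymmetrizer (n : ℕ) (ι : Type*) [DecidableEq ι] : Matrix (Fin n → ι) (Fin n → ι) ℂ :=
  Matrix.of fun x y =>
    (n.factorial : ℂ)⁻¹ * (Matrix.of fun k l => if x k = y l then (1 : ℂ) else 0).det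

theorem antisymmetrizer_apply {n : ℕ} (x y : Fin n → ι) : antisymmetrizer n ι x y =
    (n.factorial : ℂ)⁻¹ * (Matrix.of fun k l => if x k = y l then (1 : ℂ) else 0).det := rfl

theorem antisymmetrizer_comm {n : ℕ} (x y : Fin n → ι) :
    antisymmetrizer n ι x y = antisymmetrizer n ι y x := by
  rw [antisymmetrizer_apply, antisymmetrizer_apply, ← det_transpose]
  simp only [transpose, of_apply, eq_comm]

theorem antisymmetrizer_transpose (n : ℕ) : (antisymmetrizer n ι)ᵀ = antisymmetrizer n ι := by
  ext x y
  exact antisymmetrizer_comm y x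

theorem antisymmetrizer_apply_eq_sum {n : ℕ} (x y : Fin n → ι) : antisymmetrizer n ι x y =
    (n.factorial : ℂ)⁻¹ *
      ∑ π : Equiv.Perm (Fin n), ((Equiv.Perm.sign π : ℤ) : ℂ) * if x ∘ π = y then 1 else 0 := by
  simp only [antisymmetrizer_apply, det_apply', of_apply, Finset.prod_boole, funext_iff,
    Function.comp_apply, Finset.mem_univ, true_imp_iff]

theorem star_antisymmetrizer_apply {n : ℕ} (x y : Fin n → ι) :
    star (antisymmetrizer n ι x y) = antisymmetrizer n ι x y := by
  simp only [antisymmetrizer_apply_eq_sum, star_mul', star_sum, star_inv₀, star_natCast,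
    star_intCast, apply_ite star, star_one, star_zero]

theorem antisymmetrizer_isHermitian (n : ℕ) : (antisymmetrizer n ι).IsHermitian := by
  ext x y
  rw [conjTranspose_apply, star_antisymmetrizer_apply, antisymmetrizer_comm]

theorem antisymmetrizer_comp_left {n : ℕ} (π : Equiv.Perm (Fin n)) (x y : Fin n → ι) :
    antisymmetrizer n ι (x ∘ π) y =
      ((Equiv.Perm.sign π : ℤ) : ℂ) * antisymmetrizer n ι x y := by
  rw [antisymmetrizer_apply, antisymmetrizer_apply, mul_left_comm, ← det_permute]
  rfl

theorem antisymmetrizer_comp_right {n : ℕ} (π : Equiv.Perm (Fin n)) (x y : Fin n → ι) :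
    antisymmetrizer n ι x (y ∘ π) =
      ((Equiv.Perm.sign π : ℤ) : ℂ) * antisymmetrizer n ι x y := by
  rw [antisymmetrizer_comm, antisymmetrizer_comp_left, antisymmetrizer_comm]

theorem antisymmetrizer_self {n : ℕ} {x : Fin n → ι} (hx : Function.Injective x) :
    antisymmetrizer n ι x x = (n.factorial : ℂ)⁻¹ := by
  have hone : (Matrix.of fun k l => if x k = x l then (1 : ℂ) else 0) = 1 := by
    ext k l
    simp only [of_apply, Matrix.one_apply, hx.eq_iff]
  rw [antisymmetrizer_apply, hone, det_one, mul_one]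

theorem antisymmetrizer_eq_zero {n : ℕ} {x : Fin n → ι} (hx : ¬ Function.Injective x)
    (y : Fin n → ι) : antisymmetrizer n ι x y = 0 :=
  eq_zero_of_antisymmetric (f := fun z => antisymmetrizer n ι z y)
    (fun π z => antisymmetrizer_comp_left π z y) hx

variable [Fintype ι]

theorem antisymmetrizer_mul_apply {n : ℕ} {β : Type*} (M : Matrix (Fin n → ι) β ℂ)
    (x : Fin n → ι) (b : β) : (antisymmetrizer n ι * M) x b = (n.factorial : ℂ)⁻¹ *
      ∑ π : Equiv.Perm (Fin n), ((Equiv.Perm.sign π : ℤ) : ℂ) * M (x ∘ π) b := by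
  simp only [Matrix.mul_apply, antisymmetrizer_apply_eq_sum, mul_assoc, Finset.sum_mul,
    ← Finset.mul_sum]
  rw [Finset.sum_comm]
  simp only [← Finset.mul_sum, ite_mul, one_mul, zero_mul, Finset.sum_ite_eq, Finset.mem_univ,
    if_true]

theorem antisymmetrizer_mul_eq {n : ℕ} {β : Type*} {M : Matrix (Fin n → ι) β ℂ}
    (hM : ∀ (π : Equiv.Perm (Fin n)) x b,
      M (x ∘ π) b = ((Equiv.Perm.sign π : ℤ) : ℂ) * M x b) : antisymmetrizer n ι * M = M := by
  ext x b
  have hterm (π : Equiv.Perm (Fin n)) :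
      ((Equiv.Perm.sign π : ℤ) : ℂ) * M (x ∘ π) b = M x b := by
    rw [hM, ← mul_assoc, ← Int.cast_mul, Int.units_coe_mul_self, Int.cast_one, one_mul]
  simp only [antisymmetrizer_mul_apply, hterm, Finset.sum_const, Finset.card_univ,
    Fintype.card_perm, Fintype.card_fin, nsmul_eq_mul]
  rw [inv_mul_cancel_left₀ (by exact_mod_cast n.factorial_ne_zero)]

theorem antisymmetrizer_mul_self (n : ℕ) :
    antisymmetrizer n ι * antisymmetrizer n ι = antisymmetrizer n ι :=
  antisymmetrizer_mul_eq antisymmetrizer_comp_left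

theorem isStarProjection_antisymmetrizer (n : ℕ) (ι : Type*) [DecidableEq ι] [Fintype ι] :
    IsStarProjection (antisymmetrizer n ι) :=
  ⟨antisymmetrizer_mul_self n, antisymmetrizer_isHermitian n⟩

theorem antisymmetricProjector_eq_antisymmetrizer (d N : ℕ) :
    antisymmetricProjector d N = antisymmetrizer N (Fin d) := by
  rw [antisymmetricProjector, StarAlgEquiv.symm_apply_eq]
  ext1 ψ
  have hfix (φ : EuclideanSpace ℂ (Fin N → Fin d)) (hφ : φ ∈ antisymmetricSubspace d N) :
      antisymmetrizer N (Fin d) *ᵥ φ.ofLp = φ.ofLp := by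
    have h := antisymmetrizer_mul_eq (M := replicateCol Unit φ.ofLp) fun π x _ => hφ π x
    rwa [← replicateCol_mulVec, replicateCol_inj] at h
  refine Submodule.eq_starProjection_of_mem_of_inner_eq_zero ?_ fun w hw => ?_
  · intro π x
    simp only [ofLp_toEuclideanCLM, mulVec, dotProduct, Finset.mul_sum, antisymmetrizer_comp_left,
      mul_assoc]
  · rw [inner_sub_left, sub_eq_zero, EuclideanSpace.inner_eq_star_dotProduct,
      EuclideanSpace.inner_eq_star_dotProduct, ofLp_toEuclideanCLM, star_mulVec,
      (antisymmetrizer_isHermitian N).eq, dotProduct_comm w.ofLp, dotProduct_comm w.ofLp,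
      ← dotProduct_mulVec, hfix w hw]

theorem trace_antisymmetrizer (n : ℕ) :
    (antisymmetrizer n ι).trace = ((Fintype.card ι).choose n : ℂ) := by
  classical
  have hdiag (x : Fin n → ι) : antisymmetrizer n ι x x =
      if Function.Injective x then (n.factorial : ℂ)⁻¹ else 0 := by
    split_ifs with hx
    · exact antisymmetrizer_self hx
    · exact antisymmetrizer_eq_zero hx x
  have hcard : (Finset.univ.filter fun x : Fin n → ι => Function.Injective x).card =
      (Fintype.card ι).descFactorial n := by
    rw [← Fintype.card_subtype, Fintype.card_congr (Equiv.subtypeInjectiveEquivEmbedding _ _),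
      Fintype.card_embedding_eq, Fintype.card_fin]
  simp only [Matrix.trace, diag_apply, hdiag]
  rw [← Finset.sum_filter, Finset.sum_const, hcard, nsmul_eq_mul, ← div_eq_mul_inv,
    Nat.choose_eq_descFactorial_div_factorial, Nat.cast_div (Nat.factorial_dvd_descFactorial _ _)
      (by exact_mod_cast n.factorial_ne_zero)]

theorem antisymmetrizer_ne_zero {n : ℕ} (hn : n ≤ Fintype.card ι) : antisymmetrizer n ι ≠ 0 := by
  intro h
  have htrace := trace_antisymmetrizer (ι := ι) n
  rw [h, trace_zero] at htrace
  exact (Nat.choose_pos hn).ne (by exact_mod_cast htrace)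

theorem trace_antisymmetricProjector (d N : ℕ) :
    (antisymmetricProjector d N).trace = (d.choose N : ℂ) := by
  rw [antisymmetricProjector_eq_antisymmetrizer, trace_antisymmetrizer, Fintype.card_fin]

theorem antisymmetricProjectorState_eq_projectorState (d N : ℕ) :
    antisymmetricProjectorState d N = projectorState (antisymmetrizer N (Fin d)) := by
  rw [← antisymmetricProjector_eq_antisymmetrizer]
  rfl

end Antisymmetrizer

section Annihilation

variable {ι : Type*}

theorem sum_univ_fin_cons [Fintype ι] {R : Type*} [AddCommMonoid R] {n : ℕ}
    (f : (Fin (n + 1) → ι) → R) : ∑ z, f z = ∑ i : ι, ∑ x : Fin n → ι, f (Fin.cons i x) := by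
  rw [← (Fin.consEquiv fun _ : Fin (n + 1) => ι).sum_comp, Fintype.sum_prod_type]
  rfl

theorem sqrt_mul_sqrt_natCast_add_one (n : ℕ) :
    (√(n + 1 : ℝ) : ℂ) * (√(n + 1 : ℝ) : ℂ) = n + 1 := by
  rw [← Complex.ofReal_mul, Real.mul_self_sqrt (by positivity)]
  push_cast
  rfl

variable [DecidableEq ι]

theorem antisymmetrizer_cons_right {n : ℕ} (j : ι) (x : Fin (n + 1) → ι) (y : Fin n → ι) :
    ((n : ℂ) + 1) * antisymmetrizer (n + 1) ι x (Fin.cons j y) =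
      ∑ k : Fin (n + 1), (-1) ^ (k : ℕ) * (if x k = j then 1 else 0) *
        antisymmetrizer n ι (x ∘ k.succAbove) y := by
  rw [antisymmetrizer_apply, det_succ_column_zero, Nat.factorial_succ, Nat.cast_mul, mul_inv,
    Nat.cast_succ, mul_assoc, mul_inv_cancel_left₀ n.cast_add_one_ne_zero, Finset.mul_sum]
  refine Finset.sum_congr rfl fun k _ => ?_
  rw [antisymmetrizer_apply, mul_left_comm]
  rfl

theorem antisymmetrizer_cons_comp_left {n : ℕ} (π : Equiv.Perm (Fin n)) (i : ι) (x : Fin n → ι)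
    (z : Fin (n + 1) → ι) : antisymmetrizer (n + 1) ι (Fin.cons i (x ∘ π)) z =
      ((Equiv.Perm.sign π : ℤ) : ℂ) * antisymmetrizer (n + 1) ι (Fin.cons i x) z := by
  have hcons : (Fin.cons i (x ∘ π) : Fin (n + 1) → ι) =
      (Fin.cons i x : Fin (n + 1) → ι) ∘ Equiv.Perm.decomposeFin.symm (0, π) := by
    ext k
    cases k using Fin.cases <;> simp
  rw [hcons, antisymmetrizer_comp_left, Equiv.Perm.decomposeFin.symm_sign, if_pos rfl, one_mul]

/-- The annihilation operator of the mode `i`, from antisymmetric functions of `n + 1` variables to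
antisymmetric functions of `n` variables; its conjugate transpose is the creation operator. -/
def annihilation (n : ℕ) (i : ι) : Matrix (Fin n → ι) (Fin (n + 1) → ι) ℂ :=
  Matrix.of fun x z => (√(n + 1 : ℝ) : ℂ) * antisymmetrizer (n + 1) ι (Fin.cons i x) z

theorem annihilation_apply {n : ℕ} (i : ι) (x : Fin n → ι) (z : Fin (n + 1) → ι) :
    annihilation n i x z =
      (√(n + 1 : ℝ) : ℂ) * antisymmetrizer (n + 1) ι (Fin.cons i x) z := rfl

theorem conjTranspose_annihilation_apply {n : ℕ} (i : ι) (x : Fin n → ι) (z : Fin (n + 1) → ι) :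
    (annihilation n i)ᴴ z x =
      (√(n + 1 : ℝ) : ℂ) * antisymmetrizer (n + 1) ι z (Fin.cons i x) := by
  rw [conjTranspose_apply, annihilation_apply, star_mul', star_antisymmetrizer_apply,
    antisymmetrizer_comm z, Complex.star_def, Complex.conj_ofReal]

variable [Fintype ι]

theorem antisymmetrizer_mul_annihilation (n : ℕ) (i : ι) :
    antisymmetrizer n ι * annihilation n i = annihilation n i :=
  antisymmetrizer_mul_eq fun π x z => by
    rw [annihilation_apply, annihilation_apply, antisymmetrizer_cons_comp_left, mul_left_comm]

theorem annihilation_mul_conjTranspose_apply (n : ℕ) (i j : ι) (x y : Fin n → ι) :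
    (annihilation n i * (annihilation n j)ᴴ) x y =
      (n + 1) * antisymmetrizer (n + 1) ι (Fin.cons i x) (Fin.cons j y) := by
  rw [← antisymmetrizer_mul_self (n + 1), ← sqrt_mul_sqrt_natCast_add_one, Matrix.mul_apply,
    Matrix.mul_apply, Finset.mul_sum]
  refine Finset.sum_congr rfl fun z _ => ?_
  rw [conjTranspose_annihilation_apply, annihilation_apply, mul_mul_mul_comm]

theorem conjTranspose_annihilation_mul_apply (n : ℕ) (i j : ι) (x y : Fin (n + 1) → ι) :
    ((annihilation n j)ᴴ * annihilation n i) x y =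
      ∑ k : Fin (n + 1), (-1) ^ (k : ℕ) * (if x k = j then 1 else 0) *
        antisymmetrizer (n + 1) ι (Fin.cons i (x ∘ k.succAbove)) y := by
  have hproject (k : Fin (n + 1)) :
      antisymmetrizer (n + 1) ι (Fin.cons i (x ∘ k.succAbove)) y =
        ∑ z, antisymmetrizer n ι (x ∘ k.succAbove) z *
          antisymmetrizer (n + 1) ι (Fin.cons i z) y := by
    have h := antisymmetrizer_mul_eq
      (M := Matrix.of fun (z : Fin n → ι) w => antisymmetrizer (n + 1) ι (Fin.cons i z) w)
      fun π z w => antisymmetrizer_cons_comp_left π i z w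
    exact (congrFun (congrFun h (x ∘ k.succAbove)) y).symm
  simp only [Matrix.mul_apply, hproject, Finset.mul_sum]
  rw [Finset.sum_comm]
  refine Finset.sum_congr rfl fun z _ => ?_
  simp only [← mul_assoc, ← Finset.sum_mul]
  rw [conjTranspose_annihilation_apply, annihilation_apply, ← mul_assoc,
    mul_right_comm _ _ (√_ : ℂ), sqrt_mul_sqrt_natCast_add_one, antisymmetrizer_cons_right]

theorem annihilation_mul_conjTranspose_zero (i j : ι) :
    annihilation 0 i * (annihilation 0 j)ᴴ =
      (if i = j then (1 : ℂ) else 0) • antisymmetrizer 0 ι := by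
  ext x y
  rw [annihilation_mul_conjTranspose_apply, antisymmetrizer_cons_right, Fin.sum_univ_one,
    Subsingleton.elim (Fin.cons i x ∘ _) x, Fin.cons_zero, Fin.val_zero, pow_zero, one_mul,
    Matrix.smul_apply, smul_eq_mul]

theorem annihilation_mul_conjTranspose_succ (n : ℕ) (i j : ι) :
    annihilation (n + 1) i * (annihilation (n + 1) j)ᴴ =
      (if i = j then (1 : ℂ) else 0) • antisymmetrizer (n + 1) ι -
        (annihilation n j)ᴴ * annihilation n i := by
  ext x y
  rw [annihilation_mul_conjTranspose_apply, antisymmetrizer_cons_right, Fin.sum_univ_succ,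
    Matrix.sub_apply, conjTranspose_annihilation_mul_apply, sub_eq_add_neg,
    ← Finset.sum_neg_distrib]
  congr 1
  · simp [Function.comp_def]
  · refine Finset.sum_congr rfl fun k _ => ?_
    rw [Fin.cons_comp_succ_succAbove, Fin.cons_succ, Fin.val_succ, pow_succ, mul_neg_one,
      neg_mul, neg_mul]
    rfl

theorem sum_conjTranspose_mul_annihilation (n : ℕ) :
    ∑ i : ι, (annihilation n i)ᴴ * annihilation n i =
      ((n : ℂ) + 1) • antisymmetrizer (n + 1) ι := by
  ext z w
  rw [Matrix.smul_apply, ← antisymmetrizer_mul_self (n + 1), Matrix.mul_apply, sum_univ_fin_cons,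
    Matrix.sum_apply, Finset.smul_sum]
  refine Finset.sum_congr rfl fun i _ => ?_
  rw [Matrix.mul_apply, Finset.smul_sum]
  refine Finset.sum_congr rfl fun x _ => ?_
  rw [conjTranspose_annihilation_apply, annihilation_apply, smul_eq_mul,
    ← sqrt_mul_sqrt_natCast_add_one, mul_mul_mul_comm]

theorem sum_annihilation_mul_conjTranspose (n : ℕ) :
    ∑ i : ι, annihilation n i * (annihilation n i)ᴴ =
      ((Fintype.card ι : ℂ) - n) • antisymmetrizer n ι := by
  cases n with
  | zero =>
    simp only [annihilation_mul_conjTranspose_zero, if_true, one_smul, Finset.sum_const,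
      Finset.card_univ, Nat.cast_zero, sub_zero, Nat.cast_smul_eq_nsmul]
  | succ n =>
    simp only [annihilation_mul_conjTranspose_succ, if_true, one_smul, Finset.sum_sub_distrib,
      Finset.sum_const, Finset.card_univ, sum_conjTranspose_mul_annihilation, sub_smul,
      Nat.cast_smul_eq_nsmul, Nat.cast_succ]

end Annihilation

section FrobeniusSq

variable {α β γ : Type*} [Fintype α] [Fintype β] [Fintype γ]

/-- The squared Frobenius (Hilbert–Schmidt) norm. -/
def frobeniusSq (M : Matrix α β ℂ) : ℝ := ∑ i, ∑ j, Complex.normSq (M i j)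

theorem frobeniusSq_nonneg (M : Matrix α β ℂ) : 0 ≤ frobeniusSq M :=
  Finset.sum_nonneg fun _ _ => Finset.sum_nonneg fun _ _ => Complex.normSq_nonneg _

theorem eq_zero_of_frobeniusSq_eq_zero {M : Matrix α β ℂ} (h : frobeniusSq M = 0) : M = 0 := by
  ext i j
  have hrow := (Finset.sum_eq_zero_iff_of_nonneg fun i _ =>
    Finset.sum_nonneg fun _ _ => Complex.normSq_nonneg _).mp h i (Finset.mem_univ i)
  exact Complex.normSq_eq_zero.mp ((Finset.sum_eq_zero_iff_of_nonneg fun j _ =>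
    Complex.normSq_nonneg _).mp hrow j (Finset.mem_univ j))

theorem trace_conjTranspose_mul_self_eq (M : Matrix α β ℂ) :
    (Mᴴ * M).trace = (frobeniusSq M : ℂ) := by
  simp only [Matrix.trace, diag_apply, Matrix.mul_apply, conjTranspose_apply, frobeniusSq,
    Complex.ofReal_sum, Complex.normSq_eq_conj_mul_self, Complex.star_def]
  exact Finset.sum_comm

theorem sum_conjTranspose_mul_self_apply_self (M : Matrix α β ℂ) :
    ∑ j, (Mᴴ * M) j j = (frobeniusSq M : ℂ) := trace_conjTranspose_mul_self_eq M

theorem frobeniusSq_one [DecidableEq α] :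
    frobeniusSq (1 : Matrix α α ℂ) = Fintype.card α := by
  have h := trace_conjTranspose_mul_self_eq (1 : Matrix α α ℂ)
  rw [conjTranspose_one, Matrix.one_mul, trace_one] at h
  exact_mod_cast h.symm

theorem frobeniusSq_conjTranspose (M : Matrix α β ℂ) : frobeniusSq Mᴴ = frobeniusSq M := by
  rw [frobeniusSq, frobeniusSq, Finset.sum_comm]
  simp only [conjTranspose_apply, Complex.star_def, Complex.normSq_conj]

theorem frobeniusSq_smul (c : ℂ) (M : Matrix α β ℂ) :
    frobeniusSq (c • M) = Complex.normSq c * frobeniusSq M := by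
  simp only [frobeniusSq, Matrix.smul_apply, smul_eq_mul, Complex.normSq_mul, Finset.mul_sum]

theorem frobeniusSq_sub (M K : Matrix α β ℂ) :
    frobeniusSq (M - K) = frobeniusSq M - 2 * (Kᴴ * M).trace.re + frobeniusSq K := by
  have hcross : (Mᴴ * K).trace = star (Kᴴ * M).trace := by
    rw [← trace_conjTranspose, conjTranspose_mul, conjTranspose_conjTranspose]
  have h := congrArg Complex.re (trace_conjTranspose_mul_self_eq (M - K))
  rw [conjTranspose_sub, Matrix.sub_mul, Matrix.mul_sub, Matrix.mul_sub, trace_sub, trace_sub,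
    trace_sub, trace_conjTranspose_mul_self_eq, trace_conjTranspose_mul_self_eq, hcross] at h
  simp only [Complex.sub_re, Complex.ofReal_re, Complex.star_def, Complex.conj_re] at h
  linarith

theorem normSq_trace_conjTranspose_mul_le (K M : Matrix α β ℂ) :
    Complex.normSq (Kᴴ * M).trace ≤ frobeniusSq K * frobeniusSq M := by
  have htrace : (Kᴴ * M).trace = ∑ p : β × α, star (K p.2 p.1) * M p.2 p.1 :=
    (Fintype.sum_prod_type fun p : β × α => star (K p.2 p.1) * M p.2 p.1).symm
  have hsum (L : Matrix α β ℂ) : ∑ p : β × α, ‖L p.2 p.1‖ ^ 2 = frobeniusSq L := by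
    rw [Fintype.sum_prod_type, Finset.sum_comm, frobeniusSq]
    simp only [Complex.normSq_eq_norm_sq]
  rw [Complex.normSq_eq_norm_sq, htrace, ← hsum, ← hsum]
  calc ‖∑ p : β × α, star (K p.2 p.1) * M p.2 p.1‖ ^ 2
      ≤ (∑ p : β × α, ‖K p.2 p.1‖ * ‖M p.2 p.1‖) ^ 2 := by
        gcongr
        refine (norm_sum_le _ _).trans_eq (Finset.sum_congr rfl fun p _ => ?_)
        rw [norm_mul, norm_star]
    _ ≤ _ := Finset.sum_mul_sq_le_sq_mul_sq _ _ _

theorem normSq_trace_le (M : Matrix α α ℂ) :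
    Complex.normSq M.trace ≤ Fintype.card α * frobeniusSq M := by
  classical
  simpa only [conjTranspose_one, Matrix.one_mul, frobeniusSq_one] using
    normSq_trace_conjTranspose_mul_le 1 M

theorem frobeniusSq_sum_mul {κ : Type*} [Fintype κ] (W : κ → Matrix α β ℂ)
    (C : κ → Matrix β γ ℂ) : (frobeniusSq (∑ j, W j * C j) : ℂ) =
      ∑ l, ∑ j, ((W l)ᴴ * W j * (C j * (C l)ᴴ)).trace := by
  rw [← trace_conjTranspose_mul_self_eq, conjTranspose_sum, Matrix.sum_mul, trace_sum]
  refine Finset.sum_congr rfl fun l _ => ?_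
  rw [Matrix.mul_sum, trace_sum]
  refine Finset.sum_congr rfl fun j _ => ?_
  rw [conjTranspose_mul, Matrix.mul_assoc, trace_mul_comm]
  simp only [Matrix.mul_assoc]

theorem sum_frobeniusSq_sub_smul {κ : Type*} [Fintype κ] (W : κ → Matrix α β ℂ)
    {C : κ → Matrix β γ ℂ} {P : Matrix γ γ ℂ} {c : ℝ} (hc : c ≠ 0)
    (hC : ∑ j, (C j)ᴴ * C j = (c : ℂ) • P) (hP : ∀ j, C j * P = C j) :
    ∑ j, frobeniusSq (W j - ((c⁻¹ : ℝ) : ℂ) • ((∑ l, W l * C l) * (C j)ᴴ)) =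
      ∑ j, frobeniusSq (W j) - c⁻¹ * frobeniusSq (∑ l, W l * C l) := by
  set Y := ∑ l, W l * C l with hY
  have hYP : Y * P = Y := by
    rw [hY, Matrix.sum_mul]
    exact Finset.sum_congr rfl fun j _ => by rw [Matrix.mul_assoc, hP]
  have hcross : ∑ j, ((Y * (C j)ᴴ)ᴴ * W j).trace.re = frobeniusSq Y := by
    rw [← Complex.re_sum, ← Complex.ofReal_re (frobeniusSq Y), ← trace_conjTranspose_mul_self_eq]
    conv_rhs => rw [hY, Matrix.mul_sum, trace_sum]
    refine congrArg _ (Finset.sum_congr rfl fun j _ => ?_)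
    rw [conjTranspose_mul, conjTranspose_conjTranspose, Matrix.mul_assoc, trace_mul_comm,
      Matrix.mul_assoc]
  have hsq : ∑ j, frobeniusSq (Y * (C j)ᴴ) = c * frobeniusSq Y := by
    have hterm (j : κ) : (frobeniusSq (Y * (C j)ᴴ) : ℂ) = (Yᴴ * (Y * ((C j)ᴴ * C j))).trace := by
      rw [← trace_conjTranspose_mul_self_eq, conjTranspose_mul, conjTranspose_conjTranspose,
        Matrix.mul_assoc, trace_mul_comm, Matrix.mul_assoc, Matrix.mul_assoc]
    rw [← Complex.ofReal_inj, Complex.ofReal_sum, Complex.ofReal_mul]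
    simp only [hterm]
    rw [← trace_sum, ← Matrix.mul_sum, ← Matrix.mul_sum, hC, Matrix.mul_smul, hYP,
      Matrix.mul_smul, trace_smul, trace_conjTranspose_mul_self_eq, smul_eq_mul]
  simp only [frobeniusSq_sub, frobeniusSq_smul, conjTranspose_smul, Matrix.smul_mul, trace_smul,
    smul_eq_mul, Complex.star_def, Complex.conj_ofReal, Complex.re_ofReal_mul,
    Complex.normSq_ofReal, Finset.sum_add_distrib, Finset.sum_sub_distrib, ← Finset.mul_sum,
    hcross, hsq]
  field_simp
  ring

/-- Cauchy–Schwarz for `∑ j, W j * C j`, where the column `C` is a multiple of a partial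
isometry. -/
theorem frobeniusSq_sum_mul_le {κ : Type*} [Fintype κ] (W : κ → Matrix α β ℂ)
    {C : κ → Matrix β γ ℂ} {P : Matrix γ γ ℂ} {c : ℝ} (hc : 0 < c)
    (hC : ∑ j, (C j)ᴴ * C j = (c : ℂ) • P) (hP : ∀ j, C j * P = C j) :
    frobeniusSq (∑ j, W j * C j) ≤ c * ∑ j, frobeniusSq (W j) := by
  rw [← inv_mul_le_iff₀ hc, ← sub_nonneg, ← sum_frobeniusSq_sub_smul W hc.ne' hC hP]
  exact Finset.sum_nonneg fun j _ => frobeniusSq_nonneg _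

end FrobeniusSq

section WedgeContraction

variable {ι : Type*} [DecidableEq ι] [Fintype ι]

theorem conjTranspose_annihilation_mul_antisymmetrizer (n : ℕ) (i : ι) :
    (annihilation n i)ᴴ * antisymmetrizer n ι = (annihilation n i)ᴴ := by
  have h := congrArg conjTranspose (antisymmetrizer_mul_annihilation n i)
  rwa [conjTranspose_mul, (antisymmetrizer_isHermitian n).eq] at h

theorem sum_conjTranspose_mul_conjTranspose_annihilation (n : ℕ) :
    ∑ i : ι, ((annihilation n i)ᴴ)ᴴ * (annihilation n i)ᴴ =
      ((Fintype.card ι - n : ℝ) : ℂ) • antisymmetrizer n ι := by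
  simp only [conjTranspose_conjTranspose, sum_annihilation_mul_conjTranspose, Complex.ofReal_sub,
    Complex.ofReal_natCast]

/-- The `j`-th column of a single-particle operator `A`, created in front of the `n`-particle
operator `M`. -/
def creationColumn {n : ℕ} (A : Matrix ι ι ℂ) (M : Matrix (Fin n → ι) (Fin n → ι) ℂ) (j : ι) :
    Matrix (Fin (n + 1) → ι) (Fin n → ι) ℂ :=
  ∑ i, A i j • ((annihilation n i)ᴴ * M)

/-- The `j`-th column of a single-particle operator `A`, annihilated from the outputs of the
`(n + 1)`-particle operator `M`. -/
def annihilationColumn {n : ℕ} (A : Matrix ι ι ℂ)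
    (M : Matrix (Fin (n + 1) → ι) (Fin (n + 1) → ι) ℂ) (j : ι) :
    Matrix (Fin n → ι) (Fin (n + 1) → ι) ℂ :=
  ∑ i, star (A i j) • (annihilation n i * M)

/-- The `i`-th row of a single-particle operator `A`, annihilated from the inputs of the
`(n + 1)`-particle operator `M`. -/
def annihilationRow {n : ℕ} (A : Matrix ι ι ℂ)
    (M : Matrix (Fin (n + 1) → ι) (Fin (n + 1) → ι) ℂ) (i : ι) :
    Matrix (Fin (n + 1) → ι) (Fin n → ι) ℂ :=
  ∑ j, (star (A i j) • M) * (annihilation n j)ᴴ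

/-- The antisymmetrized product of a single-particle operator and an `n`-particle operator. -/
def wedge {n : ℕ} (A : Matrix ι ι ℂ) (M : Matrix (Fin n → ι) (Fin n → ι) ℂ) :
    Matrix (Fin (n + 1) → ι) (Fin (n + 1) → ι) ℂ :=
  ∑ j, creationColumn A M j * annihilation n j

/-- The contraction of an `(n + 1)`-particle operator with the adjoint of a single-particle
operator; it is the adjoint of `wedge`. -/
def contraction {n : ℕ} (A : Matrix ι ι ℂ) (M : Matrix (Fin (n + 1) → ι) (Fin (n + 1) → ι) ℂ) :
    Matrix (Fin n → ι) (Fin n → ι) ℂ :=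
  ∑ j, annihilationColumn A M j * (annihilation n j)ᴴ

theorem contraction_eq_sum_mul_annihilationRow {n : ℕ} (A : Matrix ι ι ℂ)
    (M : Matrix (Fin (n + 1) → ι) (Fin (n + 1) → ι) ℂ) :
    contraction A M = ∑ i, annihilation n i * annihilationRow A M i := by
  simp only [contraction, annihilationColumn, annihilationRow, Matrix.sum_mul, Matrix.mul_sum,
    Matrix.smul_mul, Matrix.mul_smul, Matrix.mul_assoc]
  exact Finset.sum_comm

theorem antisymmetrizer_mul_contraction {n : ℕ} (A : Matrix ι ι ℂ)
    (M : Matrix (Fin (n + 1) → ι) (Fin (n + 1) → ι) ℂ) :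
    antisymmetrizer n ι * contraction A M = contraction A M := by
  rw [contraction_eq_sum_mul_annihilationRow, Matrix.mul_sum]
  simp only [← Matrix.mul_assoc, antisymmetrizer_mul_annihilation]

theorem contraction_mul_antisymmetrizer {n : ℕ} (A : Matrix ι ι ℂ)
    (M : Matrix (Fin (n + 1) → ι) (Fin (n + 1) → ι) ℂ) :
    contraction A M * antisymmetrizer n ι = contraction A M := by
  simp only [contraction, Matrix.sum_mul, Matrix.mul_assoc,
    conjTranspose_annihilation_mul_antisymmetrizer]

theorem trace_conjTranspose_wedge_mul {n : ℕ} (A : Matrix ι ι ℂ)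
    (K : Matrix (Fin n → ι) (Fin n → ι) ℂ) (M : Matrix (Fin (n + 1) → ι) (Fin (n + 1) → ι) ℂ) :
    ((wedge A K)ᴴ * M).trace = (Kᴴ * contraction A M).trace := by
  simp only [wedge, creationColumn, contraction, annihilationColumn, conjTranspose_sum,
    conjTranspose_mul, conjTranspose_smul, conjTranspose_conjTranspose, Matrix.sum_mul,
    Matrix.mul_sum, trace_sum, Matrix.smul_mul, Matrix.mul_smul, trace_smul]
  refine Finset.sum_congr rfl fun j _ => Finset.sum_congr rfl fun i _ => ?_
  rw [Matrix.mul_assoc, trace_mul_comm]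
  simp only [Matrix.mul_assoc]

theorem conjTranspose_creationColumn_mul {n : ℕ} (A : Matrix ι ι ℂ)
    (M : Matrix (Fin n → ι) (Fin n → ι) ℂ) (l j : ι) :
    (creationColumn A M l)ᴴ * creationColumn A M j = ∑ i, ∑ k, (star (A i l) * A k j) •
      (Mᴴ * (annihilation n i * (annihilation n k)ᴴ * M)) := by
  simp only [creationColumn, conjTranspose_sum, conjTranspose_smul, conjTranspose_mul,
    conjTranspose_conjTranspose, Matrix.sum_mul, Matrix.mul_sum, Matrix.smul_mul, Matrix.mul_smul,
    Matrix.mul_assoc, Finset.smul_sum, smul_smul, mul_comm (A _ _)]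
  exact Finset.sum_comm

theorem sum_sum_smul_ite_smul {β : Type*} (A : Matrix ι ι ℂ) (l j : ι)
    (K : Matrix β β ℂ) :
    ∑ i, ∑ k, (star (A i l) * A k j) • ((if i = k then (1 : ℂ) else 0) • K) =
      (Aᴴ * A) l j • K := by
  simp only [ite_smul, one_smul, zero_smul, smul_ite, smul_zero, Finset.sum_ite_eq,
    Finset.mem_univ, if_true, Matrix.mul_apply, conjTranspose_apply, Finset.sum_smul]

theorem conjTranspose_creationColumn_mul_zero {A : Matrix ι ι ℂ}
    {M : Matrix (Fin 0 → ι) (Fin 0 → ι) ℂ} (hM : antisymmetrizer 0 ι * M = M) (l j : ι) :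
    (creationColumn A M l)ᴴ * creationColumn A M j = (Aᴴ * A) l j • (Mᴴ * M) := by
  simp only [conjTranspose_creationColumn_mul, annihilation_mul_conjTranspose_zero,
    Matrix.smul_mul, Matrix.mul_smul, hM, sum_sum_smul_ite_smul]

theorem conjTranspose_creationColumn_mul_succ {n : ℕ} {A : Matrix ι ι ℂ}
    {M : Matrix (Fin (n + 1) → ι) (Fin (n + 1) → ι) ℂ} (hM : antisymmetrizer (n + 1) ι * M = M)
    (l j : ι) : (creationColumn A M l)ᴴ * creationColumn A M j =
      (Aᴴ * A) l j • (Mᴴ * M) - (annihilationColumn A M j)ᴴ * annihilationColumn A M l := by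
  simp only [conjTranspose_creationColumn_mul, annihilation_mul_conjTranspose_succ,
    Matrix.sub_mul, Matrix.mul_sub, Matrix.smul_mul, Matrix.mul_smul, hM, smul_sub,
    Finset.sum_sub_distrib, sum_sum_smul_ite_smul]
  congr 1
  simp only [annihilationColumn, conjTranspose_sum, conjTranspose_smul, conjTranspose_mul,
    star_star, Matrix.sum_mul, Matrix.mul_sum, Matrix.smul_mul, Matrix.mul_smul, Matrix.mul_assoc,
    Finset.smul_sum, smul_smul]

theorem frobeniusSq_wedge_zero {A : Matrix ι ι ℂ} {M : Matrix (Fin 0 → ι) (Fin 0 → ι) ℂ}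
    (hM : antisymmetrizer 0 ι * M = M) (hM' : M * antisymmetrizer 0 ι = M) :
    frobeniusSq (wedge A M) = frobeniusSq A * frobeniusSq M := by
  rw [← Complex.ofReal_inj, wedge, frobeniusSq_sum_mul]
  simp only [annihilation_mul_conjTranspose_zero, conjTranspose_creationColumn_mul_zero hM,
    Matrix.mul_smul, Matrix.smul_mul, Matrix.mul_assoc Mᴴ M, trace_smul, hM',
    trace_conjTranspose_mul_self_eq, smul_eq_mul, ite_mul, one_mul, zero_mul,
    Finset.sum_ite_eq', Finset.mem_univ, if_true]
  rw [← Finset.sum_mul, sum_conjTranspose_mul_self_apply_self, Complex.ofReal_mul]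

theorem sum_frobeniusSq_annihilationRow {n : ℕ} (A : Matrix ι ι ℂ)
    (M : Matrix (Fin (n + 1) → ι) (Fin (n + 1) → ι) ℂ) :
    ∑ i, (frobeniusSq (annihilationRow A M i) : ℂ) =
      ∑ l, ∑ j, (Aᴴ * A) l j * (Mᴴ * M * ((annihilation n l)ᴴ * annihilation n j)).trace := by
  have hrow (i : ι) : (frobeniusSq (annihilationRow A M i) : ℂ) =
      ∑ l, ∑ j, star (A i l) * A i j *
        (Mᴴ * M * ((annihilation n l)ᴴ * annihilation n j)).trace := by
    rw [annihilationRow, frobeniusSq_sum_mul, Finset.sum_comm]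
    refine Finset.sum_congr rfl fun l _ => Finset.sum_congr rfl fun j _ => ?_
    rw [conjTranspose_smul, star_star, conjTranspose_conjTranspose, Matrix.smul_mul,
      Matrix.mul_smul, smul_smul, Matrix.smul_mul, trace_smul, smul_eq_mul, mul_comm (A i j)]
  simp only [hrow, Matrix.mul_apply (M := Aᴴ), conjTranspose_apply, Finset.sum_mul]
  rw [Finset.sum_comm]
  exact Finset.sum_congr rfl fun l _ => Finset.sum_comm

theorem frobeniusSq_contraction_eq_sum {n : ℕ} (A : Matrix ι ι ℂ)
    (M : Matrix (Fin (n + 1) → ι) (Fin (n + 1) → ι) ℂ) :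
    (frobeniusSq (contraction A M) : ℂ) = ∑ l, ∑ j, ((annihilationColumn A M j)ᴴ *
      annihilationColumn A M l * ((annihilation n l)ᴴ * annihilation n j)).trace := by
  rw [contraction, frobeniusSq_sum_mul, Finset.sum_comm]
  simp only [conjTranspose_conjTranspose]

theorem frobeniusSq_wedge_succ_eq_sum {n : ℕ} (A : Matrix ι ι ℂ)
    {M : Matrix (Fin (n + 1) → ι) (Fin (n + 1) → ι) ℂ} (hM' : M * antisymmetrizer (n + 1) ι = M) :
    (frobeniusSq (wedge A M) : ℂ) =
      ∑ j, ((creationColumn A M j)ᴴ * creationColumn A M j).trace -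
        ∑ l, ∑ j, ((creationColumn A M l)ᴴ * creationColumn A M j *
          ((annihilation n l)ᴴ * annihilation n j)).trace := by
  have hcolumn (j : ι) : creationColumn A M j * antisymmetrizer (n + 1) ι =
      creationColumn A M j := by
    simp only [creationColumn, Matrix.sum_mul, Matrix.smul_mul, Matrix.mul_assoc, hM']
  rw [wedge, frobeniusSq_sum_mul]
  simp only [annihilation_mul_conjTranspose_succ, Matrix.mul_sub, Matrix.mul_smul, trace_sub,
    trace_smul, Finset.sum_sub_distrib, Matrix.mul_assoc (creationColumn A M _)ᴴ _
    (antisymmetrizer _ _), hcolumn, smul_eq_mul, ite_mul, one_mul, zero_mul,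
    Finset.sum_ite_eq',
    Finset.mem_univ, if_true]

theorem frobeniusSq_wedge_succ {n : ℕ} {A : Matrix ι ι ℂ}
    {M : Matrix (Fin (n + 1) → ι) (Fin (n + 1) → ι) ℂ} (hM : antisymmetrizer (n + 1) ι * M = M)
    (hM' : M * antisymmetrizer (n + 1) ι = M) :
    frobeniusSq (wedge A M) = frobeniusSq A * frobeniusSq M -
      ∑ j, frobeniusSq (annihilationColumn A M j) - ∑ i, frobeniusSq (annihilationRow A M i) +
      frobeniusSq (contraction A M) := by
  rw [← Complex.ofReal_inj, frobeniusSq_wedge_succ_eq_sum A hM']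
  simp only [conjTranspose_creationColumn_mul_succ hM, Matrix.sub_mul, Matrix.smul_mul, trace_sub,
    trace_smul, smul_eq_mul, Finset.sum_sub_distrib, trace_conjTranspose_mul_self_eq,
    ← Finset.sum_mul, sum_conjTranspose_mul_self_apply_self, ← sum_frobeniusSq_annihilationRow,
    ← frobeniusSq_contraction_eq_sum]
  push_cast
  ring

theorem frobeniusSq_contraction_le_column {n : ℕ} (hn : n < Fintype.card ι) (A : Matrix ι ι ℂ)
    (M : Matrix (Fin (n + 1) → ι) (Fin (n + 1) → ι) ℂ) : frobeniusSq (contraction A M) ≤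
      (Fintype.card ι - n) * ∑ j, frobeniusSq (annihilationColumn A M j) :=
  frobeniusSq_sum_mul_le _ (sub_pos.mpr (by exact_mod_cast hn))
    (sum_conjTranspose_mul_conjTranspose_annihilation n)
    (conjTranspose_annihilation_mul_antisymmetrizer n)

theorem frobeniusSq_contraction_le_row {n : ℕ} (hn : n < Fintype.card ι) (A : Matrix ι ι ℂ)
    (M : Matrix (Fin (n + 1) → ι) (Fin (n + 1) → ι) ℂ) : frobeniusSq (contraction A M) ≤
      (Fintype.card ι - n) * ∑ i, frobeniusSq (annihilationRow A M i) := by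
  have h := frobeniusSq_sum_mul_le (fun i => (annihilationRow A M i)ᴴ)
    (sub_pos.mpr (by exact_mod_cast hn)) (sum_conjTranspose_mul_conjTranspose_annihilation n)
    (conjTranspose_annihilation_mul_antisymmetrizer n)
  simpa only [frobeniusSq_conjTranspose, ← conjTranspose_mul, ← conjTranspose_sum,
    ← contraction_eq_sum_mul_annihilationRow] using h

theorem frobeniusSq_contraction_le_of_wedge_le {n : ℕ} {A : Matrix ι ι ℂ} {c : ℝ} (hc : 0 ≤ c)
    (h : ∀ K : Matrix (Fin n → ι) (Fin n → ι) ℂ, antisymmetrizer n ι * K = K →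
      K * antisymmetrizer n ι = K → frobeniusSq (wedge A K) ≤ c * frobeniusSq K)
    (M : Matrix (Fin (n + 1) → ι) (Fin (n + 1) → ι) ℂ) :
    frobeniusSq (contraction A M) ≤ c * frobeniusSq M := by
  set Y := contraction A M with hY
  rcases (frobeniusSq_nonneg Y).eq_or_lt with hY0 | hYpos
  · rw [← hY0]
    exact mul_nonneg hc (frobeniusSq_nonneg M)
  have hadjoint : ((wedge A Y)ᴴ * M).trace = (frobeniusSq Y : ℂ) := by
    rw [trace_conjTranspose_wedge_mul, ← hY, trace_conjTranspose_mul_self_eq]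
  have hwedge := h Y (antisymmetrizer_mul_contraction A M) (contraction_mul_antisymmetrizer A M)
  refine le_of_mul_le_mul_left ?_ hYpos
  calc frobeniusSq Y * frobeniusSq Y
      ≤ frobeniusSq (wedge A Y) * frobeniusSq M := by
        simpa only [hadjoint, Complex.normSq_ofReal] using
          normSq_trace_conjTranspose_mul_le (wedge A Y) M
    _ ≤ c * frobeniusSq Y * frobeniusSq M :=
        mul_le_mul_of_nonneg_right hwedge (frobeniusSq_nonneg M)
    _ = frobeniusSq Y * (c * frobeniusSq M) := by ring

/-- The constant is the ratio attained at `A = 1` and `M = antisymmetrizer n ι`. -/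
theorem frobeniusSq_wedge_le {n : ℕ} (hn : n < Fintype.card ι) (A : Matrix ι ι ℂ)
    {M : Matrix (Fin n → ι) (Fin n → ι) ℂ} (hM : antisymmetrizer n ι * M = M)
    (hM' : M * antisymmetrizer n ι = M) : frobeniusSq (wedge A M) ≤
      ((n + 1) * (Fintype.card ι - n) / Fintype.card ι * frobeniusSq A) * frobeniusSq M := by
  have hd : (0 : ℝ) < Fintype.card ι := by exact_mod_cast (Nat.zero_le n).trans_lt hn
  induction n with
  | zero => simp [frobeniusSq_wedge_zero hM hM', hd.ne']
  | succ n ih =>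
    have hn' : n < Fintype.card ι := (Nat.lt_succ_self n).trans hn
    have hn2 : (n : ℝ) + 2 ≤ Fintype.card ι := by exact_mod_cast hn
    have hdn : (0 : ℝ) < Fintype.card ι - n := by linarith
    have hA := frobeniusSq_nonneg A
    have hcontraction : frobeniusSq (contraction A M) / (Fintype.card ι - n) ≤
        (n + 1) / Fintype.card ι * frobeniusSq A * frobeniusSq M := by
      rw [div_le_iff₀ hdn]
      refine (frobeniusSq_contraction_le_of_wedge_le (by positivity)
        (fun K hK hK' => ih hn' hK hK') M).trans_eq ?_
      ring
    have hcolumn := frobeniusSq_contraction_le_column hn' A M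
    have hrow := frobeniusSq_contraction_le_row hn' A M
    rw [← div_le_iff₀' hdn] at hcolumn hrow
    rw [frobeniusSq_wedge_succ hM hM']
    set Y := frobeniusSq (contraction A M)
    set a := frobeniusSq A
    set m := frobeniusSq M
    set d : ℝ := (Fintype.card ι : ℝ)
    calc a * m - ∑ j, frobeniusSq (annihilationColumn A M j) -
          ∑ i, frobeniusSq (annihilationRow A M i) + Y
        ≤ a * m - Y / (d - n) - Y / (d - n) + Y := by gcongr
      _ = a * m + (d - n - 2) * (Y / (d - n)) := by field_simp; ring
      _ ≤ a * m + (d - n - 2) * ((n + 1) / d * a * m) :=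
          add_le_add_right (mul_le_mul_of_nonneg_left hcontraction (by linarith)) _
      _ = _ := by push_cast; field_simp; ring

end WedgeContraction

section WedgeNorm

variable {ι : Type*} [DecidableEq ι] [Fintype ι]

theorem sum_comp_perm {n : ℕ} {κ : Type*} [Fintype κ] {R : Type*} [AddCommMonoid R]
    (π : Equiv.Perm (Fin n)) (f : (Fin n → κ) → R) : ∑ x, f (x ∘ π) = ∑ x, f x :=
  (π.arrowCongr (Equiv.refl κ)).symm.sum_comp f

theorem wedge_antisymmetrizer_conj_productMatrix {n : ℕ} (A : Fin (n + 1) → Matrix ι ι ℂ) :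
    wedge (A 0) (antisymmetrizer n ι * productMatrix (fun k => A k.succ) * antisymmetrizer n ι) =
      ((n : ℂ) + 1) •
        (antisymmetrizer (n + 1) ι * productMatrix A * antisymmetrizer (n + 1) ι) := by
  have habsorb (K : Matrix (Fin n → ι) (Fin n → ι) ℂ) (i j : ι) :
      (annihilation n i)ᴴ * (antisymmetrizer n ι * K * antisymmetrizer n ι) * annihilation n j =
        (annihilation n i)ᴴ * K * annihilation n j := by
    rw [← Matrix.mul_assoc, ← Matrix.mul_assoc, conjTranspose_annihilation_mul_antisymmetrizer,
      Matrix.mul_assoc _ _ (annihilation n j), antisymmetrizer_mul_annihilation]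
  simp only [wedge, creationColumn, Matrix.sum_mul, Matrix.smul_mul, habsorb]
  ext z w
  simp only [Matrix.sum_apply, Matrix.smul_apply, Matrix.mul_apply, sum_univ_fin_cons, smul_eq_mul,
    Finset.sum_mul, Finset.mul_sum, conjTranspose_annihilation_apply, annihilation_apply]
  refine Finset.sum_congr rfl fun j _ => ?_
  rw [Finset.sum_comm]
  refine Finset.sum_congr rfl fun y _ => Finset.sum_congr rfl fun i _ =>
    Finset.sum_congr rfl fun x _ => ?_
  have hsplit : productMatrix A (Fin.cons i x) (Fin.cons j y) =
      A 0 i j * productMatrix (fun k => A k.succ) x y := Fin.prod_univ_succ _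
  rw [hsplit, ← sqrt_mul_sqrt_natCast_add_one]
  ring

/-- The squared Hilbert–Schmidt norm of `P (A₁ ⊗ ⋯ ⊗ Aₙ) P`, where `P` is the antisymmetrizer. It
is the overlap of `P ⊗ P` with the product vector whose factors have coefficient matrices `A k`. -/
def wedgeNormSq {n : ℕ} (A : Fin n → Matrix ι ι ℂ) : ℝ :=
  frobeniusSq (antisymmetrizer n ι * productMatrix A * antisymmetrizer n ι)

theorem sq_mul_wedgeNormSq_succ {n : ℕ} (A : Fin (n + 1) → Matrix ι ι ℂ) :
    ((n : ℝ) + 1) ^ 2 * wedgeNormSq A = frobeniusSq (wedge (A 0)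
      (antisymmetrizer n ι * productMatrix (fun k => A k.succ) * antisymmetrizer n ι)) := by
  rw [wedge_antisymmetrizer_conj_productMatrix, frobeniusSq_smul, wedgeNormSq, ← Nat.cast_succ,
    ← Nat.cast_succ, Complex.normSq_natCast, sq]

theorem wedgeNormSq_succ_le {n : ℕ} (hn : n < Fintype.card ι) (A : Fin (n + 1) → Matrix ι ι ℂ) :
    wedgeNormSq A ≤ (Fintype.card ι - n) / ((n + 1) * Fintype.card ι) * frobeniusSq (A 0) *
      wedgeNormSq fun k => A k.succ := by
  have hd : (0 : ℝ) < Fintype.card ι := by exact_mod_cast (Nat.zero_le n).trans_lt hn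
  have hP := antisymmetrizer_mul_self (ι := ι) n
  have h := frobeniusSq_wedge_le hn (A 0)
    (M := antisymmetrizer n ι * productMatrix (fun k => A k.succ) * antisymmetrizer n ι)
    (by rw [Matrix.mul_assoc, ← Matrix.mul_assoc, hP]) (by rw [Matrix.mul_assoc, hP])
  rw [← sq_mul_wedgeNormSq_succ, ← wedgeNormSq] at h
  refine le_of_mul_le_mul_left (h.trans_eq ?_) (show (0 : ℝ) < (n + 1) ^ 2 by positivity)
  field_simp

theorem choose_succ_div_pow_succ {d n : ℕ} (hn : n < d) :
    (d.choose (n + 1) : ℝ) / (d : ℝ) ^ (n + 1) =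
      (d - n) / ((n + 1) * d) * (d.choose n / (d : ℝ) ^ n) := by
  have hd : (0 : ℝ) < d := by exact_mod_cast (Nat.zero_le n).trans_lt hn
  have hchoose : (d.choose (n + 1) : ℝ) * (n + 1) = d.choose n * (d - n) := by
    rw [← Nat.cast_sub hn.le]
    exact_mod_cast Nat.choose_succ_right_eq d n
  rw [eq_div_of_mul_eq (by positivity) hchoose, pow_succ]
  field_simp

theorem wedgeNormSq_zero (A : Fin 0 → Matrix ι ι ℂ) : wedgeNormSq A = 1 := by
  simp [wedgeNormSq, frobeniusSq, antisymmetrizer_apply, productMatrix_apply, Matrix.mul_apply]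

theorem wedgeNormSq_le {n : ℕ} (hn : n ≤ Fintype.card ι) (A : Fin n → Matrix ι ι ℂ) :
    wedgeNormSq A ≤
      (Fintype.card ι).choose n / (Fintype.card ι : ℝ) ^ n * ∏ k, frobeniusSq (A k) := by
  induction n with
  | zero => simp [wedgeNormSq_zero]
  | succ n ih =>
    have hdn : (0 : ℝ) < Fintype.card ι - n := sub_pos.mpr (by exact_mod_cast hn)
    have hA := frobeniusSq_nonneg (A 0)
    calc wedgeNormSq A ≤ (Fintype.card ι - n) / ((n + 1) * Fintype.card ι) * frobeniusSq (A 0) *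
          wedgeNormSq fun k => A k.succ := wedgeNormSq_succ_le hn A
      _ ≤ (Fintype.card ι - n) / ((n + 1) * Fintype.card ι) * frobeniusSq (A 0) *
          ((Fintype.card ι).choose n / (Fintype.card ι : ℝ) ^ n *
            ∏ k : Fin n, frobeniusSq (A k.succ)) := by
        gcongr
        exact ih (Nat.le_of_succ_le hn) _
      _ = _ := by
        rw [Fin.prod_univ_succ, choose_succ_div_pow_succ hn]
        ring

theorem wedgeNormSq_comp_perm {n : ℕ} (A : Fin n → Matrix ι ι ℂ) (π : Equiv.Perm (Fin n)) :
    wedgeNormSq (A ∘ π) = wedgeNormSq A := by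
  have hsign : ((Equiv.Perm.sign π : ℤ) : ℂ) * ((Equiv.Perm.sign π : ℤ) : ℂ) = 1 := by
    rw [← Int.cast_mul, Int.units_coe_mul_self, Int.cast_one]
  rw [wedgeNormSq, wedgeNormSq]
  congr 1
  ext z w
  simp only [Matrix.mul_apply]
  rw [← sum_comp_perm π]
  refine Finset.sum_congr rfl fun y _ => ?_
  rw [← sum_comp_perm π, antisymmetrizer_comp_left, ← mul_assoc, Finset.sum_mul, Finset.sum_mul,
    Finset.sum_mul]
  refine Finset.sum_congr rfl fun x _ => ?_
  have hprod : productMatrix (A ∘ π) (x ∘ π) (y ∘ π) = productMatrix A x y :=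
    Equiv.prod_comp π fun k => A k (x k) (y k)
  rw [antisymmetrizer_comp_right, hprod]
  linear_combination antisymmetrizer n ι z x * productMatrix A x y * antisymmetrizer n ι y w * hsign

theorem antisymmetrizer_conj_productMatrix_const {n : ℕ} (A : Matrix ι ι ℂ) :
    antisymmetrizer n ι * productMatrix (fun _ => A) * antisymmetrizer n ι =
      antisymmetrizer n ι * productMatrix fun _ => A := by
  have h := antisymmetrizer_mul_eq
    (M := (antisymmetrizer n ι * productMatrix fun _ : Fin n => A)ᵀ) fun π y x => by
      rw [transpose_apply, transpose_apply, Matrix.mul_apply, Matrix.mul_apply, ← sum_comp_perm π,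
        Finset.mul_sum]
      refine Finset.sum_congr rfl fun z _ => ?_
      rw [antisymmetrizer_comp_right, mul_assoc]
      congr 2
      exact Equiv.prod_comp π fun k => A (z k) (y k)
  have h' := congrArg transpose h
  rwa [transpose_mul, transpose_transpose, antisymmetrizer_transpose] at h'

theorem wedgeNormSq_const {n : ℕ} {A : Matrix ι ι ℂ}
    (hA : A * Aᴴ = (Fintype.card ι : ℂ)⁻¹ • (1 : Matrix ι ι ℂ)) :
    wedgeNormSq (fun _ : Fin n => A) = (Fintype.card ι).choose n / (Fintype.card ι : ℝ) ^ n := by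
  have hproduct : (productMatrix fun _ : Fin n => A) * (productMatrix fun _ : Fin n => A)ᴴ =
      ((Fintype.card ι : ℂ) ^ n)⁻¹ • (1 : Matrix (Fin n → ι) (Fin n → ι) ℂ) := by
    rw [conjTranspose_productMatrix, productMatrix_mul]
    ext x y
    simp only [productMatrix_apply, hA, Matrix.smul_apply, Matrix.one_apply, smul_eq_mul,
      Finset.prod_mul_distrib, Finset.prod_const, Finset.card_univ, Fintype.card_fin, inv_pow,
      Finset.prod_boole, funext_iff, Finset.mem_univ, true_imp_iff]
  rw [wedgeNormSq, antisymmetrizer_conj_productMatrix_const, ← Complex.ofReal_inj,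
    ← trace_conjTranspose_mul_self_eq, trace_mul_comm, conjTranspose_mul,
    (antisymmetrizer_isHermitian n).eq, Matrix.mul_assoc, ← Matrix.mul_assoc (productMatrix _),
    hproduct, Matrix.smul_mul, Matrix.one_mul, Matrix.mul_smul, antisymmetrizer_mul_self,
    trace_smul, trace_antisymmetrizer, smul_eq_mul]
  push_cast
  rw [div_eq_inv_mul]

end WedgeNorm

section WedgeNormEquality

variable {ι : Type*} [Fintype ι]

theorem eq_trace_smul_of_normSq_trace_eq_one {α β : Type*} [Fintype α] [Fintype β]
    {A B : Matrix α β ℂ} (hA : frobeniusSq A = 1) (hB : frobeniusSq B = 1)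
    (h : Complex.normSq (Aᴴ * B).trace = 1) : B = (Aᴴ * B).trace • A := by
  refine sub_eq_zero.mp (eq_zero_of_frobeniusSq_eq_zero ?_)
  rw [frobeniusSq_sub, frobeniusSq_smul, conjTranspose_smul, Matrix.smul_mul, trace_smul, hA, hB,
    h, smul_eq_mul, Complex.star_def, ← Complex.normSq_eq_conj_mul_self, h, Complex.ofReal_one,
    Complex.one_re]
  norm_num

theorem eq_inv_card_smul_one_of_frobeniusSq_eq [DecidableEq ι] {M : Matrix ι ι ℂ}
    (htrace : M.trace = 1) (h : frobeniusSq M = (Fintype.card ι : ℝ)⁻¹) :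
    M = (Fintype.card ι : ℂ)⁻¹ • (1 : Matrix ι ι ℂ) := by
  refine sub_eq_zero.mp (eq_zero_of_frobeniusSq_eq_zero ?_)
  rw [frobeniusSq_sub, h, frobeniusSq_smul, frobeniusSq_one, conjTranspose_smul,
    conjTranspose_one, Matrix.smul_mul, Matrix.one_mul, trace_smul, htrace, smul_eq_mul, mul_one,
    star_inv₀, star_natCast, map_inv₀, Complex.normSq_natCast, ← Complex.ofReal_natCast,
    ← Complex.ofReal_inv, Complex.ofReal_re]
  field_simp
  ring

theorem sum_univ_fin_one_pi {R : Type*} [AddCommMonoid R] (f : (Fin 1 → ι) → R) :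
    ∑ z, f z = ∑ i, f fun _ => i :=
  ((Equiv.funUnique (Fin 1) ι).symm.sum_comp f).symm

theorem antisymmetrizer_one {ι : Type*} [DecidableEq ι] : antisymmetrizer 1 ι = 1 := by
  ext x y
  simp [antisymmetrizer_apply, Matrix.one_apply, funext_iff]

theorem annihilation_zero_apply {ι : Type*} [DecidableEq ι] (i : ι) (x : Fin 0 → ι)
    (z : Fin 1 → ι) : annihilation 0 i x z = if z 0 = i then 1 else 0 := by
  rw [annihilation_apply, antisymmetrizer_one]
  simp [Matrix.one_apply, funext_iff, eq_comm]

variable [DecidableEq ι]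

theorem annihilationColumn_productMatrix_apply (A : Matrix ι ι ℂ) (B : Fin 1 → Matrix ι ι ℂ)
    (j : ι) (x : Fin 0 → ι) (w : Fin 1 → ι) :
    annihilationColumn A (productMatrix B) j x w = (Aᴴ * B 0) j (w 0) := by
  simp [annihilationColumn, Matrix.sum_apply, Matrix.mul_apply, annihilation_zero_apply,
    sum_univ_fin_one_pi, productMatrix_apply]

theorem annihilationRow_productMatrix_apply (A : Matrix ι ι ℂ) (B : Fin 1 → Matrix ι ι ℂ)
    (i : ι) (z : Fin 1 → ι) (x : Fin 0 → ι) :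
    annihilationRow A (productMatrix B) i z x = (B 0 * Aᴴ) (z 0) i := by
  simp [annihilationRow, Matrix.sum_apply, Matrix.mul_apply, annihilation_zero_apply,
    sum_univ_fin_one_pi, productMatrix_apply, apply_ite, mul_comm]

theorem contraction_productMatrix_apply (A : Matrix ι ι ℂ) (B : Fin 1 → Matrix ι ι ℂ)
    (x y : Fin 0 → ι) : contraction A (productMatrix B) x y = (Aᴴ * B 0).trace := by
  simp [contraction, Matrix.sum_apply, Matrix.mul_apply (M := annihilationColumn _ _ _),
    annihilationColumn_productMatrix_apply, annihilation_zero_apply, sum_univ_fin_one_pi,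
    apply_ite, Matrix.trace]

theorem four_mul_wedgeNormSq_two (A : Fin 2 → Matrix ι ι ℂ) :
    4 * wedgeNormSq A = frobeniusSq (A 0) * frobeniusSq (A 1) - frobeniusSq ((A 0)ᴴ * A 1) -
      frobeniusSq (A 1 * (A 0)ᴴ) + Complex.normSq ((A 0)ᴴ * A 1).trace := by
  have hfactor : frobeniusSq (productMatrix fun k : Fin 1 => A k.succ) = frobeniusSq (A 1) := by
    simp [frobeniusSq, sum_univ_fin_one_pi, productMatrix_apply]
  have hcolumn : ∑ j, frobeniusSq (annihilationColumn (A 0)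
      (productMatrix fun k : Fin 1 => A k.succ) j) = frobeniusSq ((A 0)ᴴ * A 1) := by
    simp [frobeniusSq, annihilationColumn_productMatrix_apply, sum_univ_fin_one_pi]
  have hrow : ∑ i, frobeniusSq (annihilationRow (A 0)
      (productMatrix fun k : Fin 1 => A k.succ) i) = frobeniusSq (A 1 * (A 0)ᴴ) := by
    simp only [frobeniusSq, annihilationRow_productMatrix_apply, Finset.univ_unique,
      Finset.sum_singleton, Nat.reduceAdd, sum_univ_fin_one_pi]
    exact Finset.sum_comm
  have hcontraction : frobeniusSq (contraction (A 0) (productMatrix fun k : Fin 1 => A k.succ)) =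
      Complex.normSq ((A 0)ᴴ * A 1).trace := by
    simp [frobeniusSq, contraction_productMatrix_apply]
  have hexpand := frobeniusSq_wedge_succ (A := A 0) (M := productMatrix fun k : Fin 1 => A k.succ)
    (by rw [antisymmetrizer_one, Matrix.one_mul]) (by rw [antisymmetrizer_one, Matrix.mul_one])
  have h := sq_mul_wedgeNormSq_succ A
  rw [antisymmetrizer_one, Matrix.one_mul, Matrix.mul_one, hexpand, hfactor, hcolumn, hrow,
    hcontraction] at h
  norm_num at h
  exact h

theorem exists_smul_and_isometry_of_le_wedgeNormSq_two (hd : 3 ≤ Fintype.card ι)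
    {A : Fin 2 → Matrix ι ι ℂ} (hA : ∀ k, frobeniusSq (A k) = 1)
    (h : (Fintype.card ι).choose 2 / (Fintype.card ι : ℝ) ^ 2 ≤ wedgeNormSq A) :
    (∃ c : ℂ, A 1 = c • A 0) ∧ A 0 * (A 0)ᴴ = (Fintype.card ι : ℂ)⁻¹ • (1 : Matrix ι ι ℂ) := by
  have hd3 : (3 : ℝ) ≤ Fintype.card ι := by exact_mod_cast hd
  have hle_one := normSq_trace_conjTranspose_mul_le (A 0) (A 1)
  have hle_left := normSq_trace_le ((A 0)ᴴ * A 1)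
  have hle_right := normSq_trace_le (A 1 * (A 0)ᴴ)
  have hexpand := four_mul_wedgeNormSq_two A
  rw [trace_mul_comm] at hle_right
  rw [hA, hA] at hle_one hexpand
  rw [Nat.cast_choose_two] at h
  set d : ℝ := (Fintype.card ι : ℝ)
  set Y := Complex.normSq ((A 0)ᴴ * A 1).trace with hY
  have hlower : 2 * (d - 1) ≤
      (1 - frobeniusSq ((A 0)ᴴ * A 1) - frobeniusSq (A 1 * (A 0)ᴴ) + Y) * d := by
    rw [div_div, div_le_iff₀ (by positivity)] at h
    nlinarith
  have hY1 : Y = 1 := by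
    refine le_antisymm (by linarith) (le_of_mul_le_mul_left ?_ (show 0 < d - 2 by linarith))
    linarith
  have hparallel := eq_trace_smul_of_normSq_trace_eq_one (hA 0) (hA 1) hY1
  refine ⟨⟨_, hparallel⟩, eq_inv_card_smul_one_of_frobeniusSq_eq ?_ ?_⟩
  · rw [trace_mul_comm, trace_conjTranspose_mul_self_eq, hA, Complex.ofReal_one]
  · have hfrob : frobeniusSq (A 1 * (A 0)ᴴ) = d⁻¹ :=
      eq_inv_of_mul_eq_one_left (by rw [hY1] at hlower hle_left hle_right; linarith)
    rwa [hparallel, Matrix.smul_mul, frobeniusSq_smul, ← hY, hY1, one_mul] at hfrob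

theorem exists_smul_and_isometry_of_le_wedgeNormSq_last {n : ℕ} (hd : 3 ≤ Fintype.card ι)
    (hn : n + 2 ≤ Fintype.card ι) {A : Fin (n + 2) → Matrix ι ι ℂ}
    (hA : ∀ k, frobeniusSq (A k) = 1)
    (h : (Fintype.card ι).choose (n + 2) / (Fintype.card ι : ℝ) ^ (n + 2) ≤ wedgeNormSq A) :
    (∃ c : ℂ, A (Fin.last (n + 1)) = c • A (Fin.last n).castSucc) ∧
      A (Fin.last n).castSucc * (A (Fin.last n).castSucc)ᴴ =
        (Fintype.card ι : ℂ)⁻¹ • (1 : Matrix ι ι ℂ) := by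
  induction n with
  | zero => exact exists_smul_and_isometry_of_le_wedgeNormSq_two hd hA h
  | succ n ih =>
    refine ih (Nat.le_of_succ_le hn) (A := fun k => A k.succ) (fun k => hA _) ?_
    have hdn : (0 : ℝ) < Fintype.card ι - (n + 2 : ℕ) := sub_pos.mpr (by exact_mod_cast hn)
    have : (0 : ℝ) < Fintype.card ι := by exact_mod_cast (by omega : 0 < Fintype.card ι)
    have hstep := h.trans (wedgeNormSq_succ_le (n := n + 2) hn A)
    rw [hA, mul_one, show n + 1 + 2 = n + 2 + 1 from rfl, choose_succ_div_pow_succ hn] at hstep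
    exact le_of_mul_le_mul_left hstep (by positivity)

theorem exists_smul_and_isometry_of_le_wedgeNormSq {n : ℕ} (hd : 3 ≤ Fintype.card ι)
    (hn : n ≤ Fintype.card ι) {A : Fin n → Matrix ι ι ℂ} (hA : ∀ k, frobeniusSq (A k) = 1)
    (h : (Fintype.card ι).choose n / (Fintype.card ι : ℝ) ^ n ≤ wedgeNormSq A)
    {k l : Fin n} (hkl : k ≠ l) :
    (∃ c : ℂ, A l = c • A k) ∧ A k * (A k)ᴴ = (Fintype.card ι : ℂ)⁻¹ • (1 : Matrix ι ι ℂ) := by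
  obtain _ | _ | n := n
  · exact k.elim0
  · exact absurd (Subsingleton.elim (α := Fin 1) k l) hkl
  · have hlast : Function.Injective ![(Fin.last n).castSucc, Fin.last (n + 1)] := by
      rw [Function.Injective, Fin.forall_fin_two]
      simp [Fin.forall_fin_two, (Fin.castSucc_lt_last _).ne, (Fin.castSucc_lt_last _).ne']
    have hpair : Function.Injective ![k, l] := by
      rw [Function.Injective, Fin.forall_fin_two]
      simp [Fin.forall_fin_two, hkl, hkl.symm]
    obtain ⟨π, hπ⟩ := Equiv.Perm.exists_extending_pair _ _ hlast hpair
    have hk : π (Fin.last n).castSucc = k := hπ 0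
    have hl : π (Fin.last (n + 1)) = l := hπ 1
    simpa only [Function.comp_apply, hk, hl] using
      exists_smul_and_isometry_of_le_wedgeNormSq_last hd hn (A := A ∘ π) (fun k => hA _)
        (by rwa [wedgeNormSq_comp_perm])

end WedgeNormEquality

section TensorState

variable {N n : ℕ} {ι : Fin n → Type*}

theorem tensorState_apply (ρ : ∀ j, Matrix (Fin N → ι j) (Fin N → ι j) ℂ)
    (x y : Fin N → ∀ j, ι j) :
    tensorState ρ x y = ∏ j, ρ j (fun k => x k j) (fun k => y k j) := rfl

theorem tensorState_eq_submatrix (ρ : ∀ j, Matrix (Fin N → ι j) (Fin N → ι j) ℂ) :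
    tensorState ρ = (piKronecker ρ).submatrix (Equiv.piComm _) (Equiv.piComm _) := rfl

theorem conjTranspose_tensorState (ρ : ∀ j, Matrix (Fin N → ι j) (Fin N → ι j) ℂ) :
    (tensorState ρ)ᴴ = tensorState fun j => (ρ j)ᴴ := by
  simp only [tensorState_eq_submatrix, conjTranspose_submatrix, conjTranspose_piKronecker]

theorem tensorState_smul (c : Fin n → ℂ) (ρ : ∀ j, Matrix (Fin N → ι j) (Fin N → ι j) ℂ) :
    tensorState (fun j => c j • ρ j) = (∏ j, c j) • tensorState ρ := by
  ext x y
  simp only [tensorState_apply, Matrix.smul_apply, smul_eq_mul, Finset.prod_mul_distrib]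

theorem tensorState_productMatrix (A : Fin N → ∀ j, Matrix (ι j) (ι j) ℂ) :
    tensorState (fun j => productMatrix fun k => A k j) =
      productMatrix fun k => piKronecker (A k) := by
  ext x y
  simp only [tensorState_apply, productMatrix_apply, piKronecker_apply]
  exact Finset.prod_comm

theorem tensorState_ne_zero {ρ : ∀ j, Matrix (Fin N → ι j) (Fin N → ι j) ℂ} (hρ : ∀ j, ρ j ≠ 0) :
    tensorState ρ ≠ 0 := by
  have hentry (j : Fin n) : ∃ x y, ρ j x y ≠ 0 := by
    by_contra! hzero
    exact hρ j (Matrix.ext hzero)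
  choose x y hxy using hentry
  intro hzero
  have hprod : ∏ j, ρ j (x j) (y j) = 0 := congrFun₂ hzero (fun k j => x j k) fun k j => y j k
  exact Finset.prod_ne_zero_iff.mpr (fun j _ => hxy j) hprod

variable [∀ j, Fintype (ι j)]

theorem tensorState_mul (ρ σ : ∀ j, Matrix (Fin N → ι j) (Fin N → ι j) ℂ) :
    tensorState ρ * tensorState σ = tensorState fun j => ρ j * σ j := by
  classical
  simp only [tensorState_eq_submatrix, submatrix_mul_equiv, piKronecker_mul]

theorem trace_tensorState (ρ : ∀ j, Matrix (Fin N → ι j) (Fin N → ι j) ℂ) :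
    (tensorState ρ).trace = ∏ j, (ρ j).trace := by
  classical
  rw [← trace_piKronecker]
  exact (Equiv.piComm fun _ : Fin N => ι).sum_comp fun x => piKronecker ρ x x

variable {Q : ∀ j, Matrix (Fin N → ι j) (Fin N → ι j) ℂ}

theorem isStarProjection_tensorState (hQ : ∀ j, IsStarProjection (Q j)) :
    IsStarProjection (tensorState Q) where
  isIdempotentElem := by
    simp only [IsIdempotentElem, tensorState_mul, (hQ _).isIdempotentElem.eq]
  isSelfAdjoint := by
    simp only [IsSelfAdjoint, star_eq_conjTranspose, conjTranspose_tensorState]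
    simp only [← star_eq_conjTranspose, (hQ _).isSelfAdjoint.star_eq]

theorem tensorState_projectorState :
    (tensorState fun j => projectorState (Q j)) = projectorState (tensorState Q) := by
  simp only [projectorState, tensorState_smul, trace_tensorState, Finset.prod_inv_distrib]

theorem logb_trace_re_tensorState (hQ : ∀ j, IsStarProjection (Q j)) (hQ0 : ∀ j, Q j ≠ 0) :
    Real.logb 2 (tensorState Q).trace.re = ∑ j, Real.logb 2 (Q j).trace.re := by
  rw [← Real.logb_prod _ _ fun j _ => (trace_re_pos_of_isStarProjection (hQ j) (hQ0 j)).ne',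
    trace_tensorState]
  congr 1
  rw [← Complex.ofReal_inj, Complex.ofReal_prod,
    Finset.prod_congr rfl fun j _ => ofReal_trace_re_of_isStarProjection (hQ j),
    ← trace_tensorState, ofReal_trace_re_of_isStarProjection (isStarProjection_tensorState hQ)]

end TensorState

section LocalTwirl

universe u

/-- A local twirl collapsing `Q`: finitely many unitaries `U g`, applied by every party, such that
the sum over `g` of `K X Kᴴ * Q`, where `K = U g ⊗ ⋯ ⊗ U g`, is `c * tr (Q X)` times `Q`. This is
expressed by the entries for the matrix units `X`. -/
def HasLocalTwirl {N : ℕ} {ι : Type u} [Fintype ι] [DecidableEq ι]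
    (Q : Matrix (Fin N → ι) (Fin N → ι) ℂ) : Prop :=
  ∃ (G : Type u) (_ : Fintype G) (_ : Nonempty G) (U : G → Matrix ι ι ℂ) (c : ℂ),
    (∀ g, U g ∈ unitaryGroup ι ℂ) ∧ ∀ s t x z,
      ∑ g, productMatrix (fun _ => U g) x s *
        ((productMatrix fun _ : Fin N => U g)ᴴ * Q : Matrix _ _ ℂ) t z = c * Q t s * Q x z

theorem HasLocalTwirl.tensorState {N n : ℕ} {ι : Fin n → Type u} [∀ j, Fintype (ι j)]
    [∀ j, DecidableEq (ι j)] {Q : ∀ j, Matrix (Fin N → ι j) (Fin N → ι j) ℂ}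
    (hQ : ∀ j, HasLocalTwirl (Q j)) : HasLocalTwirl (tensorState Q) := by
  choose G hG hG0 U c hU htwirl using hQ
  refine ⟨∀ j, G j, inferInstance, inferInstance, fun g => piKronecker fun j => U j (g j),
    ∏ j, c j, fun g => piKronecker_mem_unitaryGroup fun j => hU j (g j), fun s t x z => ?_⟩
  simp only [← tensorState_productMatrix, conjTranspose_tensorState, tensorState_mul,
    tensorState_apply, ← Finset.prod_mul_distrib, ← htwirl, prod_univ_sum_univ]

theorem sum_conj_mul_of_forall_entry {G α β : Type*} [Fintype G] [Fintype α] [Fintype β]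
    {K : G → Matrix α β ℂ} {R : Matrix β β ℂ} {Q : Matrix α α ℂ} {c : ℂ}
    (h : ∀ s t x z, ∑ g, K g x s * ((K g)ᴴ * Q) t z = c * R t s * Q x z) (X : Matrix β β ℂ) :
    (∑ g, K g * X * (K g)ᴴ) * Q = (c * (R * X).trace) • Q := by
  ext x z
  calc ((∑ g, K g * X * (K g)ᴴ) * Q) x z
      = ∑ g, ∑ t, ∑ s, K g x s * X s t * ((K g)ᴴ * Q) t z := by
        rw [Matrix.sum_mul, Matrix.sum_apply]
        refine Finset.sum_congr rfl fun g _ => ?_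
        rw [Matrix.mul_assoc (K g * X), Matrix.mul_apply]
        simp only [Matrix.mul_apply (M := K g), Finset.sum_mul]
    _ = ∑ t, ∑ s, X s t * ∑ g, K g x s * ((K g)ᴴ * Q) t z := by
        rw [Finset.sum_comm]
        refine Finset.sum_congr rfl fun t _ => ?_
        rw [Finset.sum_comm]
        simp only [Finset.mul_sum]
        exact Finset.sum_congr rfl fun s _ => Finset.sum_congr rfl fun g _ => by ring
    _ = ∑ t, ∑ s, c * (R t s * X s t) * Q x z := by
        simp only [h]
        exact Finset.sum_congr rfl fun t _ => Finset.sum_congr rfl fun s _ => by ring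
    _ = ((c * (R * X).trace) • Q) x z := by
        simp only [Matrix.smul_apply, Matrix.trace, diag_apply, Matrix.mul_apply, smul_eq_mul,
          Finset.mul_sum, Finset.sum_mul]

theorem inv_card_smul_sum_mem_separableStates {N : ℕ} {ι G : Type*} [Fintype ι] [Fintype G]
    [Nonempty G] {τ : G → Matrix (Fin N → ι) (Fin N → ι) ℂ} (hτ : ∀ g, τ g ∈ separableStates N ι) :
    (Fintype.card G : ℝ)⁻¹ • ∑ g, τ g ∈ separableStates N ι := by
  rw [Finset.smul_sum]
  refine (convex_convexHull ℝ _).sum_mem (fun _ _ => by positivity) ?_ fun g _ => hτ g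
  rw [Finset.sum_const, Finset.card_univ, nsmul_eq_mul,
    mul_inv_cancel₀ (Nat.cast_ne_zero.mpr Fintype.card_ne_zero)]

variable {N : ℕ} {ι : Type u} [Fintype ι] [DecidableEq ι] {Q : Matrix (Fin N → ι) (Fin N → ι) ℂ}

theorem HasLocalTwirl.exists_mem_separableStates (h : HasLocalTwirl Q)
    (hQ0 : Q ≠ 0) {σ : Matrix (Fin N → ι) (Fin N → ι) ℂ} (hσ : σ ∈ separableStates N ι) :
    ∃ τ ∈ separableStates N ι, τ * Q = (projectorState Q * σ).trace • Q := by
  obtain ⟨G, _, _, U, c, hU, htwirl⟩ := h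
  have hcollapse := sum_conj_mul_of_forall_entry htwirl
  have hunitary (g : G) : (productMatrix fun _ : Fin N => U g) *
      (productMatrix fun _ => U g)ᴴ = 1 :=
    mem_unitaryGroup_iff.mp (piKronecker_mem_unitaryGroup fun _ => hU g)
  have hcard : (Fintype.card G : ℂ) = c * Q.trace := by
    refine smul_left_injective ℂ hQ0 ?_
    simpa only [Matrix.mul_one, hunitary, Finset.sum_const, Finset.card_univ, Matrix.smul_mul,
      Matrix.one_mul, Nat.cast_smul_eq_nsmul] using hcollapse 1
  have hcard0 : (Fintype.card G : ℂ) ≠ 0 := Nat.cast_ne_zero.mpr Fintype.card_ne_zero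
  refine ⟨_, inv_card_smul_sum_mem_separableStates fun g =>
    conj_productMatrix_mem_separableStates (fun _ => hU g) hσ, ?_⟩
  have hc : c ≠ 0 := left_ne_zero_of_mul (hcard ▸ hcard0)
  have ht : Q.trace ≠ 0 := right_ne_zero_of_mul (hcard ▸ hcard0)
  rw [Matrix.smul_mul, hcollapse, ← Complex.coe_smul, smul_smul, Complex.ofReal_inv,
    Complex.ofReal_natCast, hcard, projectorState, Matrix.smul_mul, trace_smul, smul_eq_mul]
  congr 1
  field_simp

theorem HasLocalTwirl.exists_mul_eq_maxOverlapSq_smul (h : HasLocalTwirl Q)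
    (hQ : IsStarProjection Q) (hQ0 : Q ≠ 0) :
    ∃ σ ∈ separableStates N ι, σ * Q = maxOverlapSq (projectorState Q) • Q := by
  have hstate := isState_projectorState hQ hQ0
  have := hstate.nonempty
  obtain ⟨φ, hφ, hmax⟩ := exists_isClosestProductState (projectorState Q)
  obtain ⟨σ, hσ, hσQ⟩ := h.exists_mem_separableStates hQ0 (ketbra_mem_separableStates hφ)
  refine ⟨σ, hσ, ?_⟩
  rw [hσQ, ← hmax, ← Complex.coe_smul, ofReal_expectation hstate.1]

end LocalTwirl

section LocalTwirlAntisymmetrizer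

variable {N : ℕ} {ι : Type*}

theorem exists_eq_comp_perm_of_forall_prod_sign {s t : Fin N → ι} (ht : Function.Injective t)
    (h : ∀ ε : ι → ℤˣ, (∏ k, ε (s k)) * ∏ k, ε (t k) = 1) :
    ∃ π : Equiv.Perm (Fin N), s = t ∘ π := by
  classical
  have hmem (k : Fin N) : ∃ l, s l = t k := by
    by_contra! hk
    have hsign := h fun i => if i = t k then -1 else 1
    simp only [hk, if_false, Finset.prod_const_one, ht.eq_iff, Finset.prod_ite_eq',
      Finset.mem_univ, if_true, one_mul] at hsign
    exact absurd hsign (by decide)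
  choose f hf using hmem
  have hf_injective : Function.Injective f := fun a b hab => ht (by rw [← hf a, ← hf b, hab])
  refine ⟨(Equiv.ofBijective f (Finite.injective_iff_bijective.mp hf_injective)).symm,
    funext fun l => ?_⟩
  rw [Function.comp_apply, ← hf, Equiv.ofBijective_apply_symm_apply f]

variable [DecidableEq ι]

/-- The monomial matrix permuting the basis by `τ` after changing its signs by `ε`. -/
def signedPermMatrix (τ : Equiv.Perm ι) (ε : ι → ℤˣ) : Matrix ι ι ℂ :=
  Matrix.of fun a b => if a = τ b then ((ε b : ℤ) : ℂ) else 0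

theorem productMatrix_signedPermMatrix_apply (τ : Equiv.Perm ι) (ε : ι → ℤˣ) (x s : Fin N → ι) :
    productMatrix (fun _ => signedPermMatrix τ ε) x s =
      if x = τ ∘ s then (((∏ k, ε (s k) : ℤˣ) : ℤ) : ℂ) else 0 := by
  simp only [productMatrix_apply, signedPermMatrix, of_apply, Finset.prod_ite_zero,
    Finset.mem_univ, true_imp_iff, funext_iff, Function.comp_apply]
  push_cast
  rfl

variable [Fintype ι]

theorem sum_prod_sign_mul_prod_sign_eq_zero {s t : Fin N → ι} (ht : Function.Injective t)
    (hst : ∀ π : Equiv.Perm (Fin N), s ≠ t ∘ π) :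
    ∑ ε : ι → ℤˣ, ((((∏ k, ε (s k)) * ∏ k, ε (t k) : ℤˣ) : ℤ) : ℂ) = 0 := by
  let χ : (ι → ℤˣ) →* ℂ := ((Int.castRingHom ℂ).toMonoidHom.comp (Units.coeHom ℤ)).comp
    { toFun := fun ε => (∏ k, ε (s k)) * ∏ k, ε (t k)
      map_one' := by simp
      map_mul' := fun ε ε' => by
        simp only [Pi.mul_apply, Finset.prod_mul_distrib, mul_mul_mul_comm] }
  refine sum_hom_units_eq_zero χ fun hχ => ?_
  obtain ⟨π, hπ⟩ := exists_eq_comp_perm_of_forall_prod_sign ht fun ε =>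
    Units.ext (Int.cast_injective (α := ℂ) (by simpa [χ] using DFunLike.congr_fun hχ ε))
  exact hst π hπ

theorem card_perm_comp_eq {t₀ y₀ t y : Fin N → ι} (ht₀ : Function.Injective t₀)
    (hy₀ : Function.Injective y₀) (ht : Function.Injective t) (hy : Function.Injective y) :
    Finset.card {τ : Equiv.Perm ι | y = τ ∘ t} = Finset.card {τ : Equiv.Perm ι | y₀ = τ ∘ t₀} := by
  obtain ⟨σ, hσ⟩ := Equiv.Perm.exists_extending_pair t t₀ ht ht₀
  obtain ⟨ρ, hρ⟩ := Equiv.Perm.exists_extending_pair y y₀ hy hy₀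
  refine Finset.card_equiv ((Equiv.mulLeft ρ).trans (Equiv.mulRight σ⁻¹)) fun τ => ?_
  simp only [Finset.mem_filter, Finset.mem_univ, true_and, funext_iff, Function.comp_apply,
    ← hσ, ← hρ, Equiv.trans_apply, Equiv.coe_mulLeft, Equiv.coe_mulRight, Equiv.Perm.mul_apply,
    Equiv.Perm.coe_inv, Equiv.symm_apply_apply, ρ.injective.eq_iff]

theorem signedPermMatrix_mem_unitaryGroup (τ : Equiv.Perm ι) (ε : ι → ℤˣ) :
    signedPermMatrix τ ε ∈ unitaryGroup ι ℂ := by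
  rw [mem_unitaryGroup_iff']
  ext a b
  simp only [star_eq_conjTranspose, Matrix.mul_apply, conjTranspose_apply, signedPermMatrix,
    of_apply, mul_ite, mul_zero, Finset.sum_ite_eq', Finset.mem_univ, if_true,
    τ.injective.eq_iff, Matrix.one_apply]
  rcases eq_or_ne b a with rfl | hab
  · simp [← Int.cast_mul]
  · simp [hab, hab.symm]

theorem conjTranspose_productMatrix_signedPermMatrix_mul_apply {β : Type*} (τ : Equiv.Perm ι)
    (ε : ι → ℤˣ) (M : Matrix (Fin N → ι) β ℂ) (t : Fin N → ι) (z : β) :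
    ((productMatrix fun _ : Fin N => signedPermMatrix τ ε)ᴴ * M) t z =
      (((∏ k, ε (t k) : ℤˣ) : ℤ) : ℂ) * M (τ ∘ t) z := by
  simp only [Matrix.mul_apply, conjTranspose_apply, productMatrix_signedPermMatrix_apply,
    apply_ite star, star_zero, star_intCast, ite_mul, zero_mul, Finset.sum_ite_eq',
    Finset.mem_univ, if_true]

theorem sum_signedPermMatrix_mul_antisymmetrizer (s t x z : Fin N → ι) :
    ∑ g : Equiv.Perm ι × (ι → ℤˣ), productMatrix (fun _ => signedPermMatrix g.1 g.2) x s *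
        ((productMatrix fun _ : Fin N => signedPermMatrix g.1 g.2)ᴴ *
          antisymmetrizer N ι : Matrix _ _ ℂ) t z =
      (∑ τ : Equiv.Perm ι, if x = τ ∘ s then antisymmetrizer N ι (τ ∘ t) z else 0) *
        ∑ ε : ι → ℤˣ, ((((∏ k, ε (s k)) * ∏ k, ε (t k) : ℤˣ) : ℤ) : ℂ) := by
  simp only [Fintype.sum_prod_type, conjTranspose_productMatrix_signedPermMatrix_mul_apply,
    productMatrix_signedPermMatrix_apply, Finset.sum_mul_sum, Units.val_mul, Int.cast_mul]
  refine Finset.sum_congr rfl fun τ _ => Finset.sum_congr rfl fun ε _ => ?_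
  split_ifs <;> ring

theorem sum_perm_antisymmetrizer_comp {t₀ t : Fin N → ι} (ht₀ : Function.Injective t₀)
    (ht : Function.Injective t) (π : Equiv.Perm (Fin N))
    (x z : Fin N → ι) :
    (∑ τ : Equiv.Perm ι, if x = τ ∘ (t ∘ π) then antisymmetrizer N ι (τ ∘ t) z else 0) =
      Finset.card {τ : Equiv.Perm ι | t₀ = τ ∘ t₀} *
        (((Equiv.Perm.sign π : ℤ) : ℂ) * antisymmetrizer N ι x z) := by
  have hterm (τ : Equiv.Perm ι) (hτ : x = τ ∘ (t ∘ π)) : antisymmetrizer N ι (τ ∘ t) z =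
      ((Equiv.Perm.sign π : ℤ) : ℂ) * antisymmetrizer N ι x z := by
    rw [hτ, ← Function.comp_assoc, antisymmetrizer_comp_left, ← mul_assoc, ← Int.cast_mul,
      Int.units_coe_mul_self, Int.cast_one, one_mul]
  by_cases hx : Function.Injective x
  · rw [← Finset.sum_filter, Finset.sum_congr rfl fun τ hτ => hterm τ (Finset.mem_filter.mp hτ).2,
      Finset.sum_const, nsmul_eq_mul, card_perm_comp_eq ht₀ ht₀ (ht.comp π.injective) hx]
  · rw [antisymmetrizer_eq_zero hx, mul_zero, mul_zero]
    refine Finset.sum_eq_zero fun τ _ => ite_eq_right_iff.mpr fun hτ => ?_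
    rw [hterm τ hτ, antisymmetrizer_eq_zero hx, mul_zero]

theorem hasLocalTwirl_antisymmetrizer (hN : N ≤ Fintype.card ι) :
    HasLocalTwirl (antisymmetrizer N ι) := by
  obtain ⟨t₀⟩ : Nonempty (Fin N ↪ ι) :=
    Function.Embedding.nonempty_of_card_le (by rwa [Fintype.card_fin])
  refine ⟨Equiv.Perm ι × (ι → ℤˣ), inferInstance, inferInstance,
    fun g => signedPermMatrix g.1 g.2,
    N.factorial * Finset.card {τ : Equiv.Perm ι | t₀ = τ ∘ t₀} * Fintype.card (ι → ℤˣ),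
    fun g => signedPermMatrix_mem_unitaryGroup g.1 g.2, fun s t x z => ?_⟩
  rw [sum_signedPermMatrix_mul_antisymmetrizer]
  by_cases ht : Function.Injective t
  swap
  · have htz (τ : Equiv.Perm ι) : antisymmetrizer N ι (τ ∘ t) z = 0 :=
      antisymmetrizer_eq_zero (fun h => ht h.of_comp) z
    simp only [htz, ite_self, Finset.sum_const_zero, zero_mul, antisymmetrizer_eq_zero ht, mul_zero]
  by_cases hst : ∃ π : Equiv.Perm (Fin N), s = t ∘ π
  · obtain ⟨π, rfl⟩ := hst
    have hsign (ε : ι → ℤˣ) : (∏ k, ε ((t ∘ π) k)) * ∏ k, ε (t k) = 1 := by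
      rw [← Equiv.prod_comp π fun k => ε (t k)]
      exact Int.units_mul_self _
    rw [sum_perm_antisymmetrizer_comp t₀.injective ht π x z,
      antisymmetrizer_comp_right, antisymmetrizer_self ht]
    simp only [hsign, Units.val_one, Int.cast_one, Finset.sum_const, Finset.card_univ,
      nsmul_eq_mul, mul_one]
    field_simp
  · push Not at hst
    have hts : antisymmetrizer N ι t s = 0 := by
      rw [antisymmetrizer_apply_eq_sum]
      refine mul_eq_zero_of_right _ (Finset.sum_eq_zero fun π _ => ?_)
      rw [if_neg (hst π).symm, mul_zero]
    rw [sum_prod_sign_mul_prod_sign_eq_zero ht hst, hts, mul_zero, mul_zero, zero_mul]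

end LocalTwirlAntisymmetrizer

section EntanglementMeasures

variable {N : ℕ}

theorem logGlobalRobustness_nonneg {ι : Type*} [Fintype ι]
    (ρ : Matrix (Fin N → ι) (Fin N → ι) ℂ) : 0 ≤ logGlobalRobustness ρ :=
  Real.logb_nonneg one_lt_two (le_add_of_nonneg_right (Real.sInf_nonneg fun _ ht => ht.1))

theorem expectation_projectorState {α : Type*} [Fintype α] {Q : Matrix α α ℂ}
    (hQ : IsStarProjection Q) (φ : EuclideanSpace ℂ α) :
    expectation (projectorState Q) φ = Q.trace.re⁻¹ * expectation Q φ := by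
  rw [projectorState_eq_real_smul hQ, expectation_real_smul]

theorem HasLocalTwirl.logGlobalRobustness_projectorState {ι : Type*} [Fintype ι] [DecidableEq ι]
    {Q : Matrix (Fin N → ι) (Fin N → ι) ℂ} (h : HasLocalTwirl Q) (hQ : IsStarProjection Q)
    (hQ0 : Q ≠ 0) : logGlobalRobustness (projectorState Q) =
      geometricMeasure (projectorState Q) - Real.logb 2 Q.trace.re :=
  have ⟨_, hσ, hσQ⟩ := h.exists_mul_eq_maxOverlapSq_smul hQ hQ0
  Multipartite.logGlobalRobustness_projectorState hQ hQ0 hσ hσQ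

theorem HasLocalTwirl.relativeEntropyOfEntanglement_projectorState {ι : Type*} [Fintype ι]
    [DecidableEq ι] {Q : Matrix (Fin N → ι) (Fin N → ι) ℂ} (h : HasLocalTwirl Q)
    (hQ : IsStarProjection Q) (hQ0 : Q ≠ 0) :
    relativeEntropyOfEntanglement (projectorState Q) =
      ((logGlobalRobustness (projectorState Q) : ℝ) : EReal) := by
  obtain ⟨σ, hσ, hσQ⟩ := h.exists_mul_eq_maxOverlapSq_smul hQ hQ0
  rw [Multipartite.relativeEntropyOfEntanglement_projectorState hQ hQ0 hσ hσQ,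
    Multipartite.logGlobalRobustness_projectorState hQ hQ0 hσ hσQ]

variable {n d : ℕ} {D : Fin n → ℕ}

theorem tensorState_antisymmetricProjectorState :
    (tensorState fun j => antisymmetricProjectorState (D j) N) =
      projectorState (tensorState fun j => antisymmetrizer N (Fin (D j))) := by
  simp only [antisymmetricProjectorState_eq_projectorState, tensorState_projectorState]

theorem relativeEntropyOfEntanglement_tensorState_antisymmetricProjectorState
    (hD : ∀ j, N ≤ D j) :
    relativeEntropyOfEntanglement (tensorState fun j => antisymmetricProjectorState (D j) N) =
      ((logGlobalRobustness
        (tensorState fun j => antisymmetricProjectorState (D j) N) : ℝ) : EReal) := by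
  rw [tensorState_antisymmetricProjectorState]
  have hcard (j : Fin n) : N ≤ Fintype.card (Fin (D j)) := by simpa using hD j
  exact (HasLocalTwirl.tensorState fun j => hasLocalTwirl_antisymmetrizer
    (hcard j)).relativeEntropyOfEntanglement_projectorState
      (isStarProjection_tensorState fun _ => isStarProjection_antisymmetrizer N _)
      (tensorState_ne_zero fun j => antisymmetrizer_ne_zero (hcard j))

theorem logGlobalRobustness_tensorState_antisymmetricProjectorState (hD : ∀ j, N ≤ D j) :
    logGlobalRobustness (tensorState fun j => antisymmetricProjectorState (D j) N) =
      geometricMeasure (tensorState fun j => antisymmetricProjectorState (D j) N) -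
        ∑ j, Real.logb 2 (antisymmetricProjector (D j) N).trace.re := by
  have hcard (j : Fin n) : N ≤ Fintype.card (Fin (D j)) := by simpa using hD j
  have hQ (j : Fin n) := isStarProjection_antisymmetrizer N (Fin (D j))
  have hQ0 (j : Fin n) := antisymmetrizer_ne_zero (hcard j)
  simp only [antisymmetricProjector_eq_antisymmetrizer, tensorState_antisymmetricProjectorState]
  rw [← logb_trace_re_tensorState hQ hQ0]
  exact (HasLocalTwirl.tensorState fun j => hasLocalTwirl_antisymmetrizer
    (hcard j)).logGlobalRobustness_projectorState
      (isStarProjection_tensorState hQ) (tensorState_ne_zero hQ0)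

theorem logGlobalRobustness_copies_antisymmetricProjectorState (n : ℕ) (hd : N ≤ d) :
    logGlobalRobustness (copies n (antisymmetricProjectorState d N)) =
      geometricMeasure (copies n (antisymmetricProjectorState d N)) -
        n * Real.logb 2 (antisymmetricProjector d N).trace.re := by
  have h := logGlobalRobustness_tensorState_antisymmetricProjectorState (D := fun _ : Fin n => d)
    fun _ => hd
  rwa [Finset.sum_const, Finset.card_univ, Fintype.card_fin, nsmul_eq_mul] at h

theorem logGlobalRobustness_antisymmetricProjectorState_eq_sub (hd : N ≤ d) :
    logGlobalRobustness (antisymmetricProjectorState d N) =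
      geometricMeasure (antisymmetricProjectorState d N) -
        Real.logb 2 (antisymmetricProjector d N).trace.re := by
  have hcard : N ≤ Fintype.card (Fin d) := by simpa using hd
  rw [antisymmetricProjectorState_eq_projectorState, antisymmetricProjector_eq_antisymmetrizer]
  exact (hasLocalTwirl_antisymmetrizer hcard).logGlobalRobustness_projectorState
    (isStarProjection_antisymmetrizer N _) (antisymmetrizer_ne_zero hcard)

theorem relativeEntropyOfEntanglement_antisymmetricProjectorState (hd : N ≤ d) :
    relativeEntropyOfEntanglement (antisymmetricProjectorState d N) =
      ((logGlobalRobustness (antisymmetricProjectorState d N) : ℝ) : EReal) := by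
  have hcard : N ≤ Fintype.card (Fin d) := by simpa using hd
  rw [antisymmetricProjectorState_eq_projectorState]
  exact (hasLocalTwirl_antisymmetrizer hcard).relativeEntropyOfEntanglement_projectorState
    (isStarProjection_antisymmetrizer N _) (antisymmetrizer_ne_zero hcard)

end EntanglementMeasures

section TwoCopies

variable {κ : Type*}

/-- The matrix of coefficients of a vector of `ℂ^κ ⊗ ℂ^κ`. -/
def vectorMatrix (ψ : EuclideanSpace ℂ (Fin 2 → κ)) : Matrix κ κ ℂ :=
  Matrix.of fun i j => ψ ![i, j]

theorem vectorMatrix_apply (ψ : EuclideanSpace ℂ (Fin 2 → κ)) (i j : κ) :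
    vectorMatrix ψ i j = ψ ![i, j] := rfl

theorem vectorMatrix_smul (c : ℂ) (ψ : EuclideanSpace ℂ (Fin 2 → κ)) :
    vectorMatrix (c • ψ) = c • vectorMatrix ψ := rfl

theorem vectorMatrix_injective : Function.Injective (vectorMatrix (κ := κ)) := by
  intro ψ χ h
  ext x
  have hx := congrFun₂ h (x 0) (x 1)
  rwa [vectorMatrix_apply, vectorMatrix_apply,
    show ![x 0, x 1] = x from (finTwoArrowEquiv κ).symm_apply_apply x] at hx

/-- The pair of tuples formed by the first and the second particles of the parties. -/
def particlesEquiv (N : ℕ) (κ : Type*) :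
    (Fin N → κ) × (Fin N → κ) ≃ (Fin N → Fin 2 → κ) :=
  (Equiv.arrowProdEquivProdArrow (Fin N) (fun _ => κ) fun _ => κ).symm.trans
    (Equiv.piCongrRight fun _ => (finTwoArrowEquiv κ).symm)

theorem copies_two_particlesEquiv {N : ℕ} (P : Matrix (Fin N → κ) (Fin N → κ) ℂ)
    (x y z w : Fin N → κ) :
    copies 2 P (particlesEquiv N κ (x, y)) (particlesEquiv N κ (z, w)) = P x z * P y w := by
  rw [copies, tensorState_apply, Fin.prod_univ_two]
  rfl

variable [Fintype κ]

theorem productVector_particlesEquiv {N : ℕ} (a : Fin N → EuclideanSpace ℂ (Fin 2 → κ))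
    (x y : Fin N → κ) :
    productVector a (particlesEquiv N κ (x, y)) = productMatrix (fun k => vectorMatrix (a k)) x y :=
  rfl

theorem frobeniusSq_vectorMatrix (ψ : EuclideanSpace ℂ (Fin 2 → κ)) :
    frobeniusSq (vectorMatrix ψ) = ‖ψ‖ ^ 2 := by
  rw [EuclideanSpace.norm_sq_eq, ← (finTwoArrowEquiv κ).symm.sum_comp, Fintype.sum_prod_type,
    frobeniusSq]
  simp only [Complex.normSq_eq_norm_sq]
  rfl

theorem expectation_copies_two {N : ℕ} (P : Matrix (Fin N → κ) (Fin N → κ) ℂ)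
    (a : Fin N → EuclideanSpace ℂ (Fin 2 → κ)) :
    expectation (copies 2 P) (productVector a) =
      ((productMatrix fun k => vectorMatrix (a k))ᴴ *
        (P * (productMatrix fun k => vectorMatrix (a k)) * Pᵀ)).trace.re := by
  rw [expectation]
  congr 1
  simp only [dotProduct, mulVec, Matrix.trace, diag_apply, Matrix.mul_apply, Finset.sum_mul,
    ← (particlesEquiv N κ).sum_comp, Fintype.sum_prod_type, copies_two_particlesEquiv,
    productVector_particlesEquiv, Pi.star_apply, conjTranspose_apply, transpose_apply]
  rw [Finset.sum_comm]
  refine Finset.sum_congr rfl fun y _ => Finset.sum_congr rfl fun x _ => ?_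
  congr 1
  rw [Finset.sum_comm]
  exact Finset.sum_congr rfl fun w _ => Finset.sum_congr rfl fun z _ => mul_right_comm _ _ _

theorem frobeniusSq_mul_mul_of_isStarProjection {P : Matrix κ κ ℂ} (hP : IsStarProjection P)
    (K : Matrix κ κ ℂ) : frobeniusSq (P * K * P) = (Kᴴ * (P * K * P)).trace.re := by
  have hPP : P * P = P := hP.isIdempotentElem
  have hPH : Pᴴ = P := hP.isSelfAdjoint
  rw [← Complex.ofReal_re (frobeniusSq _), ← trace_conjTranspose_mul_self_eq, conjTranspose_mul,
    conjTranspose_mul, hPH]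
  congr 1
  calc (P * (Kᴴ * P) * (P * K * P)).trace
      = (P * (Kᴴ * (P * P) * K * P)).trace := by simp only [Matrix.mul_assoc]
    _ = (Kᴴ * (P * K * P)).trace := by
        rw [hPP, trace_mul_comm]
        simp only [Matrix.mul_assoc, hPP]

theorem productVector_smul {N : ℕ} (c : Fin N → ℂ) (a : Fin N → EuclideanSpace ℂ κ) :
    productVector (fun k => c k • a k) = (∏ k, c k) • productVector a := by
  ext x
  simp only [productVector_apply, PiLp.smul_apply, smul_eq_mul, Finset.prod_mul_distrib]

theorem exists_norm_eq_one_and_pow_eq {n : ℕ} (hn : n ≠ 0) {z : ℂ} (hz : ‖z‖ = 1) :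
    ∃ ω : ℂ, ‖ω‖ = 1 ∧ ω ^ n = z := by
  obtain ⟨ω, hω⟩ := IsAlgClosed.exists_pow_nat_eq z (Nat.pos_of_ne_zero hn)
  refine ⟨ω, ?_, hω⟩
  rw [← pow_eq_one_iff_of_nonneg (norm_nonneg ω) hn, ← norm_pow, hω, hz]

theorem expectation_copies_two_antisymmetrizer [DecidableEq κ] {N : ℕ}
    (a : Fin N → EuclideanSpace ℂ (Fin 2 → κ)) :
    expectation (copies 2 (antisymmetrizer N κ)) (productVector a) =
      wedgeNormSq fun k => vectorMatrix (a k) := by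
  rw [expectation_copies_two, antisymmetrizer_transpose, wedgeNormSq,
    frobeniusSq_mul_mul_of_isStarProjection (isStarProjection_antisymmetrizer N κ)]

end TwoCopies

section MaximallyEntangled

variable {N d : ℕ} {ψ : EuclideanSpace ℂ (Fin 2 → Fin d)}

theorem reducedStateFirst_eq (ψ : EuclideanSpace ℂ (Fin 2 → Fin d)) :
    reducedStateFirst ψ = vectorMatrix ψ * (vectorMatrix ψ)ᴴ := rfl

theorem IsMaximallyEntangled.norm_eq_one (hψ : IsMaximallyEntangled ψ) (hd : d ≠ 0) :
    ‖ψ‖ = 1 := by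
  have htrace := congrArg Matrix.trace hψ
  rw [reducedStateFirst_eq, trace_mul_comm, trace_conjTranspose_mul_self_eq, trace_smul, trace_one,
    Fintype.card_fin, smul_eq_mul, inv_mul_cancel₀ (Nat.cast_ne_zero.mpr hd),
    frobeniusSq_vectorMatrix] at htrace
  exact (pow_eq_one_iff_of_nonneg (norm_nonneg _) two_ne_zero).mp (by exact_mod_cast htrace)

theorem IsMaximallyEntangled.smul (hψ : IsMaximallyEntangled ψ) {ω : ℂ} (hω : ‖ω‖ = 1) :
    IsMaximallyEntangled (ω • ψ) := by
  rw [IsMaximallyEntangled, reducedStateFirst_eq, vectorMatrix_smul, conjTranspose_smul,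
    Matrix.smul_mul, Matrix.mul_smul, smul_smul, ← reducedStateFirst_eq, Complex.star_def,
    Complex.mul_conj, Complex.normSq_eq_norm_sq, hω, one_pow, Complex.ofReal_one, one_smul, hψ]

theorem exists_isMaximallyEntangled (d : ℕ) :
    ∃ ψ : EuclideanSpace ℂ (Fin 2 → Fin d), IsMaximallyEntangled ψ := by
  refine ⟨WithLp.toLp 2 fun x => if x 0 = x 1 then ((√(d : ℝ))⁻¹ : ℂ) else 0, ?_⟩
  have hsqrt : ((√(d : ℝ) : ℂ))⁻¹ * ((√(d : ℝ) : ℂ))⁻¹ = (d : ℂ)⁻¹ := by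
    rw [← mul_inv, ← Complex.ofReal_mul, Real.mul_self_sqrt (Nat.cast_nonneg d),
      Complex.ofReal_natCast]
  ext i j
  rcases eq_or_ne i j with rfl | hij
  · simp [reducedStateFirst, hsqrt]
  · simp [reducedStateFirst, hij, hij.symm]

theorem wedgeNormSq_vectorMatrix_of_isMaximallyEntangled (N : ℕ) (hψ : IsMaximallyEntangled ψ) :
    wedgeNormSq (fun _ : Fin N => vectorMatrix ψ) = d.choose N / (d : ℝ) ^ N := by
  simpa only [Fintype.card_fin] using wedgeNormSq_const (n := N) (A := vectorMatrix ψ)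
    (by rw [← reducedStateFirst_eq, Fintype.card_fin]; exact hψ)

theorem expectation_copies_two_antisymmetricProjectorState
    (a : Fin N → EuclideanSpace ℂ (Fin 2 → Fin d)) :
    expectation (copies 2 (antisymmetricProjectorState d N)) (productVector a) =
      ((d.choose N : ℝ) ^ 2)⁻¹ * wedgeNormSq fun k => vectorMatrix (a k) := by
  rw [antisymmetricProjectorState_eq_projectorState, copies, tensorState_projectorState,
    expectation_projectorState
      (isStarProjection_tensorState fun _ => isStarProjection_antisymmetrizer N _),
    trace_tensorState, ← copies, expectation_copies_two_antisymmetrizer]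
  simp only [trace_antisymmetrizer, Fintype.card_fin, Finset.prod_const, Finset.card_univ,
    ← Nat.cast_pow, Complex.natCast_re]

theorem expectation_copies_two_antisymmetricProjectorState_le (hd : N ≤ d)
    {φ : EuclideanSpace ℂ (Fin N → Fin 2 → Fin d)} (hφ : φ ∈ productStates N (Fin 2 → Fin d)) :
    expectation (copies 2 (antisymmetricProjectorState d N)) φ ≤
      ((d.choose N : ℝ) ^ 2)⁻¹ * (d.choose N / (d : ℝ) ^ N) := by
  obtain ⟨a, ha, rfl⟩ := hφ
  rw [expectation_copies_two_antisymmetricProjectorState]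
  have hle := wedgeNormSq_le (ι := Fin d) (n := N) (by simpa using hd) fun k => vectorMatrix (a k)
  simp only [frobeniusSq_vectorMatrix, ha, one_pow, Finset.prod_const_one, mul_one,
    Fintype.card_fin] at hle
  gcongr

theorem maxOverlapSq_copies_two_antisymmetricProjectorState (hd : N ≤ d) (hd0 : d ≠ 0) :
    maxOverlapSq (copies 2 (antisymmetricProjectorState d N)) =
      ((d.choose N : ℝ) ^ 2)⁻¹ * (d.choose N / (d : ℝ) ^ N) := by
  obtain ⟨ψ, hψ⟩ := exists_isMaximallyEntangled d
  rw [← wedgeNormSq_vectorMatrix_of_isMaximallyEntangled N hψ,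
    ← expectation_copies_two_antisymmetricProjectorState]
  refine maxOverlapSq_eq_of_forall_expectation_le ⟨_, fun _ => hψ.norm_eq_one hd0, rfl⟩
    fun φ hφ => ?_
  rw [expectation_copies_two_antisymmetricProjectorState,
    wedgeNormSq_vectorMatrix_of_isMaximallyEntangled N hψ]
  exact expectation_copies_two_antisymmetricProjectorState_le hd hφ

theorem IsMaximallyEntangled.isClosestProductState_copies_two (hψ : IsMaximallyEntangled ψ)
    (hd : N ≤ d) (hd0 : d ≠ 0) :
    IsClosestProductState (copies 2 (antisymmetricProjectorState d N))
      (productVector fun _ : Fin N => ψ) := by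
  refine ⟨⟨_, fun _ => hψ.norm_eq_one hd0, rfl⟩, ?_⟩
  rw [expectation_copies_two_antisymmetricProjectorState,
    wedgeNormSq_vectorMatrix_of_isMaximallyEntangled N hψ,
    maxOverlapSq_copies_two_antisymmetricProjectorState hd hd0]

theorem isMaximallyEntangled_of_isClosestProductState_copies_two (hd3 : 3 ≤ d) (hd : N ≤ d)
    {a : Fin N → EuclideanSpace ℂ (Fin 2 → Fin d)} (ha : ∀ k, ‖a k‖ = 1)
    (h : IsClosestProductState (copies 2 (antisymmetricProjectorState d N)) (productVector a))
    {k l : Fin N} (hkl : k ≠ l) :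
    IsMaximallyEntangled (a k) ∧ ∃ c : ℂ, ‖c‖ = 1 ∧ a l = c • a k := by
  have hchoose : ((d.choose N : ℝ) ^ 2)⁻¹ ≠ 0 :=
    inv_ne_zero (pow_ne_zero 2 (Nat.cast_ne_zero.mpr (Nat.choose_pos hd).ne'))
  have hmax : wedgeNormSq (fun k => vectorMatrix (a k)) = d.choose N / (d : ℝ) ^ N := by
    refine mul_left_cancel₀ hchoose ?_
    rw [← expectation_copies_two_antisymmetricProjectorState, h.2,
      maxOverlapSq_copies_two_antisymmetricProjectorState hd (by omega)]
  have hnorm (k : Fin N) : frobeniusSq (vectorMatrix (a k)) = 1 := by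
    rw [frobeniusSq_vectorMatrix, ha, one_pow]
  obtain ⟨⟨c, hc⟩, hk⟩ := exists_smul_and_isometry_of_le_wedgeNormSq (ι := Fin d)
    (by simpa using hd3) (by simpa using hd) hnorm (by rw [hmax, Fintype.card_fin]) hkl
  rw [Fintype.card_fin] at hk
  have hac : a l = c • a k := vectorMatrix_injective hc
  refine ⟨hk, c, ?_, hac⟩
  rw [← ha l, hac, norm_smul, ha k, mul_one]

theorem exists_isMaximallyEntangled_of_isClosestProductState_copies_two (hN : 3 ≤ N) (hd : N ≤ d)
    {φ : EuclideanSpace ℂ (Fin N → Fin 2 → Fin d)}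
    (hφ : IsClosestProductState (copies 2 (antisymmetricProjectorState d N)) φ) :
    ∃ ψ : EuclideanSpace ℂ (Fin 2 → Fin d), IsMaximallyEntangled ψ ∧
      φ = productVector fun _ : Fin N => ψ := by
  obtain ⟨a, ha, rfl⟩ := hφ.1
  have hpair {k l : Fin N} (hkl : k ≠ l) :=
    isMaximallyEntangled_of_isClosestProductState_copies_two (hN.trans hd) hd ha hφ hkl
  let k₀ : Fin N := ⟨0, by omega⟩
  have hmax : IsMaximallyEntangled (a k₀) :=
    (hpair (l := ⟨1, by omega⟩) (by simp [k₀])).1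
  have hphase (k : Fin N) : ∃ c : ℂ, ‖c‖ = 1 ∧ a k = c • a k₀ := by
    rcases eq_or_ne k₀ k with hk | hk
    · exact ⟨1, norm_one, by rw [hk, one_smul]⟩
    · exact (hpair hk).2
  choose c hc hac using hphase
  obtain ⟨ω, hω, hωc⟩ := exists_norm_eq_one_and_pow_eq (n := N) (z := ∏ k, c k) (by omega)
    (by rw [norm_prod, Finset.prod_congr rfl fun k _ => hc k, Finset.prod_const_one])
  refine ⟨ω • a k₀, hmax.smul hω, ?_⟩
  calc productVector a = productVector fun k => c k • a k₀ := by simp only [← hac]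
    _ = ω ^ N • productVector fun _ => a k₀ := by rw [productVector_smul, hωc]
    _ = productVector fun _ : Fin N => ω • a k₀ := by
        rw [productVector_smul, Finset.prod_const, Finset.card_univ, Fintype.card_fin]

end MaximallyEntangled

section HadamardInequality

variable {κ : Type*} [Fintype κ] [DecidableEq κ] {G : Matrix κ κ ℂ}

theorem prod_exp_eigenvalues_sub_one (hG : G.IsHermitian) (hdiag : ∀ k, G k k = 1) :
    ∏ i, Real.exp (hG.eigenvalues i - 1) = 1 := by
  have htrace : (∑ i, (hG.eigenvalues i : ℂ)) = Fintype.card κ := by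
    refine hG.trace_eq_sum_eigenvalues.symm.trans ?_
    simp only [Matrix.trace, diag_apply, hdiag, Finset.sum_const, Finset.card_univ, nsmul_eq_mul,
      mul_one]
  rw [← Real.exp_sum, Finset.sum_sub_distrib, Finset.sum_const, Finset.card_univ, nsmul_eq_mul,
    mul_one, Real.exp_eq_one_iff, sub_eq_zero]
  exact_mod_cast htrace

theorem det_re_eq_prod_eigenvalues (hG : G.IsHermitian) :
    G.det.re = ∏ i, hG.eigenvalues i := by
  rw [hG.det_eq_prod_eigenvalues]
  exact_mod_cast Complex.ofReal_re _

theorem eq_one_of_eigenvalues_eq_one (hG : G.IsHermitian) (h : ∀ i, hG.eigenvalues i = 1) :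
    G = 1 := by
  rw [hG.spectral_theorem,
    show (RCLike.ofReal ∘ hG.eigenvalues : κ → ℂ) = fun _ => 1 from funext fun i => by simp [h i],
    diagonal_one, map_one]

theorem det_re_le_one (hG : G.PosSemidef) (hdiag : ∀ k, G k k = 1) : G.det.re ≤ 1 := by
  rw [det_re_eq_prod_eigenvalues hG.isHermitian,
    ← prod_exp_eigenvalues_sub_one hG.isHermitian hdiag]
  refine Finset.prod_le_prod (fun i _ => hG.eigenvalues_nonneg i) fun i _ => ?_
  simpa only [sub_add_cancel] using Real.add_one_le_exp (hG.isHermitian.eigenvalues i - 1)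

theorem eq_one_of_det_re_eq_one (hG : G.PosSemidef) (hdiag : ∀ k, G k k = 1)
    (h : G.det.re = 1) : G = 1 := by
  rw [det_re_eq_prod_eigenvalues hG.isHermitian] at h
  refine eq_one_of_eigenvalues_eq_one hG.isHermitian ?_
  by_contra! hne
  obtain ⟨i, hi⟩ := hne
  have hpos (j : κ) : 0 < hG.isHermitian.eigenvalues j :=
    (hG.eigenvalues_nonneg j).lt_of_ne' fun hj =>
      zero_ne_one (α := ℝ) (by rw [← h, Finset.prod_eq_zero (Finset.mem_univ j) hj])
  have hlt : ∏ j, hG.isHermitian.eigenvalues j <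
      ∏ j, Real.exp (hG.isHermitian.eigenvalues j - 1) := by
    refine Finset.prod_lt_prod (fun j _ => hpos j) (fun j _ => ?_) ⟨i, Finset.mem_univ i, ?_⟩
    · simpa only [sub_add_cancel] using Real.add_one_le_exp (hG.isHermitian.eigenvalues j - 1)
    · simpa only [sub_add_cancel] using Real.add_one_lt_exp (sub_ne_zero.mpr hi)
  rw [h, prod_exp_eigenvalues_sub_one hG.isHermitian hdiag] at hlt
  exact lt_irrefl _ hlt

end HadamardInequality

section OneCopy

theorem gram_eq_one_iff_orthonormal {E κ : Type*} [NormedAddCommGroup E] [InnerProductSpace ℂ E]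
    [DecidableEq κ] (a : κ → E) : Matrix.gram ℂ a = 1 ↔ Orthonormal ℂ a := by
  rw [orthonormal_iff_ite, ← Matrix.ext_iff]
  simp only [gram_apply, Matrix.one_apply]

theorem gram_apply_self_of_norm_eq_one {E κ : Type*} [NormedAddCommGroup E]
    [InnerProductSpace ℂ E] {a : κ → E} (ha : ∀ k, ‖a k‖ = 1) (k : κ) :
    Matrix.gram ℂ a k k = 1 := by
  rw [gram_apply, inner_self_eq_norm_sq_to_K, ha, RCLike.ofReal_one, one_pow]

variable {N : ℕ} {ι : Type*} [Fintype ι]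

theorem star_productVector_dotProduct (a b : Fin N → EuclideanSpace ℂ ι) :
    star (productVector a).ofLp ⬝ᵥ (productVector b).ofLp = ∏ k, inner ℂ (a k) (b k) := by
  simp only [EuclideanSpace.inner_eq_star_dotProduct, dotProduct, Pi.star_apply,
    productVector_apply, star_prod, Finset.prod_univ_sum, Fintype.piFinset_univ,
    ← Finset.prod_mul_distrib, mul_comm]

theorem productVector_comp_perm (a : Fin N → EuclideanSpace ℂ ι) (π : Equiv.Perm (Fin N))
    (x : Fin N → ι) : productVector a (x ∘ π) = productVector (a ∘ π.symm) x := by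
  rw [productVector_apply, productVector_apply,
    ← Equiv.prod_comp π fun k => (a ∘ π.symm) k (x k)]
  simp only [Function.comp_apply, Equiv.symm_apply_apply]

theorem antisymmetrizer_mulVec_productVector [DecidableEq ι] (a : Fin N → EuclideanSpace ℂ ι) :
    (antisymmetrizer N ι).mulVec (productVector a).ofLp = (N.factorial : ℂ)⁻¹ •
      ∑ π : Equiv.Perm (Fin N), ((Equiv.Perm.sign π : ℤ) : ℂ) • (productVector (a ∘ π)).ofLp := by
  ext x
  have hsum := antisymmetrizer_mul_apply (Matrix.of fun y (_ : Unit) => productVector a y) x ()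
  refine hsum.trans ?_
  simp only [of_apply, productVector_comp_perm, Pi.smul_apply, Finset.sum_apply, smul_eq_mul]
  congr 1
  refine Fintype.sum_equiv (Equiv.inv _) _ _ fun π => ?_
  rw [Equiv.inv_apply, Equiv.Perm.sign_inv]
  rfl

theorem expectation_antisymmetrizer [DecidableEq ι] (a : Fin N → EuclideanSpace ℂ ι) :
    expectation (antisymmetrizer N ι) (productVector a) =
      (N.factorial : ℝ)⁻¹ * (Matrix.gram ℂ a).det.re := by
  rw [expectation, antisymmetrizer_mulVec_productVector, ← det_transpose, det_apply',
    dotProduct_smul, dotProduct_sum, smul_eq_mul, ← Complex.re_ofReal_mul]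
  simp only [dotProduct_smul, star_productVector_dotProduct, transpose_apply, gram_apply,
    smul_eq_mul, Function.comp_apply, Complex.ofReal_inv, Complex.ofReal_natCast]

variable {d : ℕ}

theorem expectation_antisymmetricProjectorState (a : Fin N → EuclideanSpace ℂ (Fin d)) :
    expectation (antisymmetricProjectorState d N) (productVector a) =
      (d.choose N : ℝ)⁻¹ * ((N.factorial : ℝ)⁻¹ * (Matrix.gram ℂ a).det.re) := by
  rw [antisymmetricProjectorState_eq_projectorState,
    expectation_projectorState (isStarProjection_antisymmetrizer N _), trace_antisymmetrizer,
    Fintype.card_fin, Complex.natCast_re, expectation_antisymmetrizer]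

theorem expectation_antisymmetricProjectorState_le {φ : EuclideanSpace ℂ (Fin N → Fin d)}
    (hφ : φ ∈ productStates N (Fin d)) :
    expectation (antisymmetricProjectorState d N) φ ≤
      (d.choose N : ℝ)⁻¹ * (N.factorial : ℝ)⁻¹ := by
  obtain ⟨a, ha, rfl⟩ := hφ
  rw [expectation_antisymmetricProjectorState]
  have hdet := det_re_le_one (posSemidef_gram ℂ a) (gram_apply_self_of_norm_eq_one ha)
  gcongr
  exact mul_le_of_le_one_right (by positivity) hdet

theorem expectation_antisymmetricProjectorState_of_orthonormal
    {a : Fin N → EuclideanSpace ℂ (Fin d)} (ha : Orthonormal ℂ a) :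
    expectation (antisymmetricProjectorState d N) (productVector a) =
      (d.choose N : ℝ)⁻¹ * (N.factorial : ℝ)⁻¹ := by
  rw [expectation_antisymmetricProjectorState, (gram_eq_one_iff_orthonormal a).mpr ha, det_one,
    Complex.one_re, mul_one]

theorem maxOverlapSq_antisymmetricProjectorState (hd : N ≤ d) :
    maxOverlapSq (antisymmetricProjectorState d N) =
      (d.choose N : ℝ)⁻¹ * (N.factorial : ℝ)⁻¹ := by
  let e := EuclideanSpace.basisFun (Fin d) ℂ
  have he : Orthonormal ℂ fun k : Fin N => e (Fin.castLE hd k) :=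
    e.orthonormal.comp _ (Fin.castLE_injective hd)
  rw [← expectation_antisymmetricProjectorState_of_orthonormal he]
  refine maxOverlapSq_eq_of_forall_expectation_le ⟨_, he.1, rfl⟩ fun φ hφ => ?_
  rw [expectation_antisymmetricProjectorState_of_orthonormal he]
  exact expectation_antisymmetricProjectorState_le hφ

theorem isClosestProductState_antisymmetricProjectorState_iff (hd : N ≤ d)
    (φ : EuclideanSpace ℂ (Fin N → Fin d)) :
    IsClosestProductState (antisymmetricProjectorState d N) φ ↔
      ∃ a : Fin N → EuclideanSpace ℂ (Fin d), Orthonormal ℂ a ∧ φ = productVector a := by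
  rw [IsClosestProductState, maxOverlapSq_antisymmetricProjectorState hd]
  constructor
  · rintro ⟨⟨a, ha, rfl⟩, hmax⟩
    have hchoose : (d.choose N : ℝ)⁻¹ ≠ 0 :=
      inv_ne_zero (Nat.cast_ne_zero.mpr (Nat.choose_pos hd).ne')
    have hfactorial : (N.factorial : ℝ)⁻¹ ≠ 0 :=
      inv_ne_zero (Nat.cast_ne_zero.mpr N.factorial_ne_zero)
    rw [expectation_antisymmetricProjectorState] at hmax
    have hdet := (mul_eq_left₀ hfactorial).mp (mul_left_cancel₀ hchoose hmax)
    exact ⟨a, (gram_eq_one_iff_orthonormal a).mp (eq_one_of_det_re_eq_one (posSemidef_gram ℂ a)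
      (gram_apply_self_of_norm_eq_one ha) hdet), rfl⟩
  · rintro ⟨a, ha, rfl⟩
    exact ⟨⟨a, ha.1, rfl⟩, expectation_antisymmetricProjectorState_of_orthonormal ha⟩

end OneCopy

section AppendCopies

variable {N m n : ℕ} {κ : Type*}

/-- The basis labels of `m + n` copies, regrouped as those of the first `m` and of the last `n`
copies. -/
def appendCopiesEquiv (N m n : ℕ) (κ : Type*) :
    (Fin N → Fin m → κ) × (Fin N → Fin n → κ) ≃ (Fin N → Fin (m + n) → κ) :=
  (Equiv.arrowProdEquivProdArrow (Fin N) (fun _ => Fin m → κ) (fun _ => Fin n → κ)).symm.trans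
    (Equiv.arrowCongr (Equiv.refl _) (Fin.appendEquiv m n))

theorem appendCopiesEquiv_apply (x : Fin N → Fin m → κ) (y : Fin N → Fin n → κ) (k : Fin N) :
    appendCopiesEquiv N m n κ (x, y) k = Fin.append (x k) (y k) := rfl

/-- The tensor product of a vector of `m` particles and a vector of `n` particles. -/
def appendVector (a : EuclideanSpace ℂ (Fin m → κ)) (b : EuclideanSpace ℂ (Fin n → κ)) :
    EuclideanSpace ℂ (Fin (m + n) → κ) :=
  WithLp.toLp 2 fun u => a (fun i => u (Fin.castAdd n i)) * b (fun i => u (Fin.natAdd m i))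

theorem appendVector_append (a : EuclideanSpace ℂ (Fin m → κ)) (b : EuclideanSpace ℂ (Fin n → κ))
    (x : Fin m → κ) (y : Fin n → κ) : appendVector a b (Fin.append x y) = a x * b y := by
  simp only [appendVector, Fin.append_left, Fin.append_right]

open Kronecker in
theorem submatrix_copies_add (ρ : Matrix (Fin N → κ) (Fin N → κ) ℂ) :
    (copies (m + n) ρ).submatrix (appendCopiesEquiv N m n κ) (appendCopiesEquiv N m n κ) =
      copies m ρ ⊗ₖ copies n ρ := by
  ext ⟨x, y⟩ ⟨x', y'⟩
  simp only [submatrix_apply, kroneckerMap_apply, copies, tensorState_apply, Fin.prod_univ_add,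
    appendCopiesEquiv_apply, Fin.append_left, Fin.append_right]

variable [Fintype κ]

theorem norm_appendVector (a : EuclideanSpace ℂ (Fin m → κ)) (b : EuclideanSpace ℂ (Fin n → κ)) :
    ‖appendVector a b‖ = ‖a‖ * ‖b‖ := by
  refine (sq_eq_sq₀ (norm_nonneg _) (by positivity)).mp ?_
  rw [mul_pow, EuclideanSpace.norm_sq_eq, EuclideanSpace.norm_sq_eq, EuclideanSpace.norm_sq_eq,
    ← (Fin.appendEquiv m n).sum_comp, Fintype.sum_prod_type, Finset.sum_mul_sum]
  refine Finset.sum_congr rfl fun x _ => Finset.sum_congr rfl fun y _ => ?_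
  rw [← mul_pow, ← norm_mul, ← appendVector_append]
  rfl

open Kronecker in
theorem submatrix_ketbra_productVector_appendVector (a : Fin N → EuclideanSpace ℂ (Fin m → κ))
    (b : Fin N → EuclideanSpace ℂ (Fin n → κ)) :
    (ketbra (productVector fun k => appendVector (a k) (b k))).submatrix
        (appendCopiesEquiv N m n κ) (appendCopiesEquiv N m n κ) =
      ketbra (productVector a) ⊗ₖ ketbra (productVector b) := by
  ext ⟨x, y⟩ ⟨x', y'⟩
  simp only [submatrix_apply, kroneckerMap_apply, ketbra, vecMulVec_apply, Pi.star_apply,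
    productVector_apply, appendCopiesEquiv_apply, appendVector_append, Finset.prod_mul_distrib,
    star_mul']
  ring

theorem trace_submatrix_equiv {α β : Type*} [Fintype α] [Fintype β] (e : α ≃ β)
    (A : Matrix β β ℂ) : (A.submatrix e e).trace = A.trace :=
  e.sum_comp fun i => A i i

theorem expectation_copies_add {ρ : Matrix (Fin N → κ) (Fin N → κ) ℂ}
    (hρ : (copies m ρ).PosSemidef)
    (a : Fin N → EuclideanSpace ℂ (Fin m → κ)) (b : Fin N → EuclideanSpace ℂ (Fin n → κ)) :
    expectation (copies (m + n) ρ) (productVector fun k => appendVector (a k) (b k)) =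
      expectation (copies m ρ) (productVector a) * expectation (copies n ρ) (productVector b) := by
  classical
  rw [← trace_mul_ketbra, ← trace_submatrix_equiv (appendCopiesEquiv N m n κ),
    ← submatrix_mul_equiv _ _ _ (appendCopiesEquiv N m n κ), submatrix_copies_add,
    submatrix_ketbra_productVector_appendVector, ← mul_kronecker_mul, trace_kronecker,
    ← ofReal_expectation hρ, Complex.re_ofReal_mul, trace_mul_ketbra]

theorem maxOverlapSq_copies_mul_le {ρ : Matrix (Fin N → κ) (Fin N → κ) ℂ}
    (hm : IsState (copies m ρ)) (hn : IsState (copies n ρ)) :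
    maxOverlapSq (copies m ρ) * maxOverlapSq (copies n ρ) ≤ maxOverlapSq (copies (m + n) ρ) := by
  have := hm.nonempty
  have := hn.nonempty
  obtain ⟨_, ⟨a, ha, rfl⟩, hmaxa⟩ := exists_isClosestProductState (copies m ρ)
  obtain ⟨_, ⟨b, hb, rfl⟩, hmaxb⟩ := exists_isClosestProductState (copies n ρ)
  rw [← hmaxa, ← hmaxb, ← expectation_copies_add hm.1]
  exact expectation_le_maxOverlapSq _
    ⟨_, fun k => by rw [norm_appendVector, ha, hb, mul_one], rfl⟩

theorem geometricMeasure_copies_add_le {ρ : Matrix (Fin N → κ) (Fin N → κ) ℂ}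
    (hρ : ∀ n, IsState (copies n ρ)) (m n : ℕ) :
    geometricMeasure (copies (m + n) ρ) ≤
      geometricMeasure (copies m ρ) + geometricMeasure (copies n ρ) := by
  have hm := maxOverlapSq_pos (hρ m)
  have hn := maxOverlapSq_pos (hρ n)
  rw [geometricMeasure_eq_neg_logb (hρ _), geometricMeasure_eq_neg_logb (hρ _),
    geometricMeasure_eq_neg_logb (hρ _), ← neg_add, ← Real.logb_mul hm.ne' hn.ne', neg_le_neg_iff]
  exact Real.logb_le_logb_of_le one_lt_two (mul_pos hm hn)
    (maxOverlapSq_copies_mul_le (hρ m) (hρ n))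

end AppendCopies

section Regularization

open Filter Topology

variable {N d : ℕ}

theorem isState_copies_antisymmetricProjectorState (hd : N ≤ d) (n : ℕ) :
    IsState (copies n (antisymmetricProjectorState d N)) := by
  rw [copies, tensorState_antisymmetricProjectorState]
  exact isState_projectorState
    (isStarProjection_tensorState fun _ => isStarProjection_antisymmetrizer N _)
    (tensorState_ne_zero fun _ => antisymmetrizer_ne_zero (by simpa using hd))

theorem logb_trace_antisymmetricProjector_nonneg (hd : N ≤ d) :
    0 ≤ Real.logb 2 (antisymmetricProjector d N).trace.re := by
  rw [trace_antisymmetricProjector, Complex.natCast_re]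
  exact Real.logb_nonneg one_lt_two (Nat.one_le_cast.mpr (Nat.choose_pos hd))

theorem geometricMeasure_copies_antisymmetricProjectorState_nonneg (hd : N ≤ d) (n : ℕ) :
    0 ≤ geometricMeasure (copies n (antisymmetricProjectorState d N)) := by
  have hR := logGlobalRobustness_nonneg (copies n (antisymmetricProjectorState d N))
  rw [logGlobalRobustness_copies_antisymmetricProjectorState n hd, sub_nonneg] at hR
  exact (mul_nonneg n.cast_nonneg (logb_trace_antisymmetricProjector_nonneg hd)).trans hR

theorem exists_tendsto_geometricMeasure_copies (hd : N ≤ d) : ∃ g : ℝ,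
    Tendsto (fun n : ℕ => geometricMeasure (copies n (antisymmetricProjectorState d N)) / (n : ℝ))
      atTop (𝓝 g) := by
  have hsub : Subadditive fun n => geometricMeasure (copies n (antisymmetricProjectorState d N)) :=
    geometricMeasure_copies_add_le (isState_copies_antisymmetricProjectorState hd)
  refine ⟨hsub.lim, hsub.tendsto_lim ⟨0, ?_⟩⟩
  rintro _ ⟨n, rfl⟩
  exact div_nonneg (geometricMeasure_copies_antisymmetricProjectorState_nonneg hd n) n.cast_nonneg

theorem tendsto_logGlobalRobustness_copies {g : ℝ} (hd : N ≤ d)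
    (hG : Tendsto (fun n : ℕ =>
      geometricMeasure (copies n (antisymmetricProjectorState d N)) / (n : ℝ)) atTop (𝓝 g)) :
    Tendsto (fun n : ℕ =>
      logGlobalRobustness (copies n (antisymmetricProjectorState d N)) / (n : ℝ))
      atTop (𝓝 (g - Real.logb 2 (antisymmetricProjector d N).trace.re)) := by
  refine (hG.sub_const _).congr' ?_
  filter_upwards [eventually_ne_atTop 0] with n hn
  rw [logGlobalRobustness_copies_antisymmetricProjectorState n hd, sub_div,
    mul_div_cancel_left₀ _ (Nat.cast_ne_zero.mpr hn)]

theorem tendsto_relativeEntropyOfEntanglement_copies {r : ℝ} (hd : N ≤ d)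
    (hR : Tendsto (fun n : ℕ =>
      logGlobalRobustness (copies n (antisymmetricProjectorState d N)) / (n : ℝ)) atTop (𝓝 r)) :
    Tendsto (fun n : ℕ =>
      relativeEntropyOfEntanglement (copies n (antisymmetricProjectorState d N)) / (n : EReal))
      atTop (𝓝 (r : EReal)) := by
  refine ((continuous_coe_real_ereal.tendsto _).comp hR).congr fun n => ?_
  rw [copies, relativeEntropyOfEntanglement_tensorState_antisymmetricProjectorState fun _ => hd,
    Function.comp_apply, EReal.coe_div, EReal.coe_coe_eq_natCast, copies]

end Regularization

section Values

variable {N d : ℕ}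

theorem logGlobalRobustness_antisymmetricProjectorState (hd : N ≤ d) :
    logGlobalRobustness (antisymmetricProjectorState d N) = Real.logb 2 (N.factorial : ℝ) := by
  have hchoose : (d.choose N : ℝ) ≠ 0 := Nat.cast_ne_zero.mpr (Nat.choose_pos hd).ne'
  have hstate : IsState (antisymmetricProjectorState d N) := by
    rw [antisymmetricProjectorState_eq_projectorState]
    exact isState_projectorState (isStarProjection_antisymmetrizer N _)
      (antisymmetrizer_ne_zero (by simpa using hd))
  rw [logGlobalRobustness_antisymmetricProjectorState_eq_sub hd, trace_antisymmetricProjector,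
    Complex.natCast_re, geometricMeasure_eq_neg_logb hstate,
    maxOverlapSq_antisymmetricProjectorState hd, ← mul_inv, Real.logb_inv, neg_neg,
    Real.logb_mul hchoose (Nat.cast_ne_zero.mpr N.factorial_ne_zero), add_sub_cancel_left]

theorem logGlobalRobustness_copies_two_antisymmetricProjectorState (hd : N ≤ d) (hd0 : d ≠ 0) :
    logGlobalRobustness (copies 2 (antisymmetricProjectorState d N)) =
      Real.logb 2 ((d : ℝ) ^ N * (N.factorial : ℝ) * ((d - N).factorial : ℝ) /
        (d.factorial : ℝ)) := by
  have hchoose : (d.choose N : ℝ) ≠ 0 := Nat.cast_ne_zero.mpr (Nat.choose_pos hd).ne'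
  have hpow : (d : ℝ) ^ N ≠ 0 := pow_ne_zero _ (Nat.cast_ne_zero.mpr hd0)
  have hoverlap : ((d.choose N : ℝ) ^ 2)⁻¹ * (d.choose N / (d : ℝ) ^ N) =
      (d.choose N * (d : ℝ) ^ N)⁻¹ := by
    field_simp
  have hvalue : (d : ℝ) ^ N * (N.factorial : ℝ) * ((d - N).factorial : ℝ) / (d.factorial : ℝ) =
      (d : ℝ) ^ N / d.choose N := by
    rw [Nat.cast_choose ℝ hd]
    field_simp
  rw [logGlobalRobustness_copies_antisymmetricProjectorState 2 hd, trace_antisymmetricProjector,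
    Complex.natCast_re,
    geometricMeasure_eq_neg_logb (isState_copies_antisymmetricProjectorState hd 2),
    maxOverlapSq_copies_two_antisymmetricProjectorState hd hd0, hoverlap, Real.logb_inv, neg_neg,
    Real.logb_mul hchoose hpow, hvalue, Real.logb_div hpow hchoose, Nat.cast_two]
  ring

end Values

end Multipartite

end

open Multipartite Filter Topology in
theorem mainTheorem5 (N d : ℕ) (hN : 1 ≤ N) (hd : N ≤ d) :
    -- tensor products of antisymmetric projector states
    (∀ (n : ℕ) (D : Fin n → ℕ), (∀ j, N ≤ D j) →
      relativeEntropyOfEntanglement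
          (tensorState fun j => antisymmetricProjectorState (D j) N) =
        ((logGlobalRobustness
          (tensorState fun j => antisymmetricProjectorState (D j) N) : ℝ) : EReal) ∧
      logGlobalRobustness (tensorState fun j => antisymmetricProjectorState (D j) N) =
        geometricMeasure (tensorState fun j => antisymmetricProjectorState (D j) N) -
          ∑ j, Real.logb 2 (antisymmetricProjector (D j) N).trace.re) ∧
    -- the regularized measures exist and satisfy the same relation
    (∃ g : ℝ,
      Tendsto (fun n : ℕ =>
        geometricMeasure (copies n (antisymmetricProjectorState d N)) / (n : ℝ))
        atTop (𝓝 g) ∧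
      Tendsto (fun n : ℕ =>
        logGlobalRobustness (copies n (antisymmetricProjectorState d N)) / (n : ℝ))
        atTop (𝓝 (g - Real.logb 2 (antisymmetricProjector d N).trace.re)) ∧
      Tendsto (fun n : ℕ =>
        relativeEntropyOfEntanglement (copies n (antisymmetricProjectorState d N)) / (n : EReal))
        atTop (𝓝 ((g - Real.logb 2 (antisymmetricProjector d N).trace.re : ℝ) : EReal))) ∧
    (antisymmetricProjector d N).trace = (d.choose N : ℂ) ∧
    -- one copy
    (relativeEntropyOfEntanglement (antisymmetricProjectorState d N) =
        ((logGlobalRobustness (antisymmetricProjectorState d N) : ℝ) : EReal) ∧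
      logGlobalRobustness (antisymmetricProjectorState d N) =
        geometricMeasure (antisymmetricProjectorState d N) -
          Real.logb 2 (antisymmetricProjector d N).trace.re ∧
      logGlobalRobustness (antisymmetricProjectorState d N) =
        Real.logb 2 (N.factorial : ℝ)) ∧
    -- two copies
    (relativeEntropyOfEntanglement (copies 2 (antisymmetricProjectorState d N)) =
        ((logGlobalRobustness (copies 2 (antisymmetricProjectorState d N)) : ℝ) : EReal) ∧
      logGlobalRobustness (copies 2 (antisymmetricProjectorState d N)) =
        geometricMeasure (copies 2 (antisymmetricProjectorState d N)) -
          2 * Real.logb 2 (antisymmetricProjector d N).trace.re ∧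
      logGlobalRobustness (copies 2 (antisymmetricProjectorState d N)) =
        Real.logb 2 ((d : ℝ) ^ N * (N.factorial : ℝ) * ((d - N).factorial : ℝ) /
          (d.factorial : ℝ))) ∧
    -- closest product states of one copy
    (∀ φ : EuclideanSpace ℂ (Fin N → Fin d),
      IsClosestProductState (antisymmetricProjectorState d N) φ ↔
        ∃ a : Fin N → EuclideanSpace ℂ (Fin d), Orthonormal ℂ a ∧ φ = productVector a) ∧
    -- closest product states of two copies
    (∀ ψ : EuclideanSpace ℂ (Fin 2 → Fin d), IsMaximallyEntangled ψ →
      IsClosestProductState (copies 2 (antisymmetricProjectorState d N))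
        (productVector fun _ : Fin N => ψ)) ∧
    (3 ≤ N → ∀ φ : EuclideanSpace ℂ (Fin N → Fin 2 → Fin d),
      IsClosestProductState (copies 2 (antisymmetricProjectorState d N)) φ →
        ∃ ψ : EuclideanSpace ℂ (Fin 2 → Fin d), IsMaximallyEntangled ψ ∧
          φ = productVector fun _ : Fin N => ψ) := by
  have hd0 : d ≠ 0 := by omega
  obtain ⟨g, hG⟩ := exists_tendsto_geometricMeasure_copies hd
  have hR := tendsto_logGlobalRobustness_copies hd hG
  exact ⟨fun n D hD => ⟨relativeEntropyOfEntanglement_tensorState_antisymmetricProjectorState hD,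
      logGlobalRobustness_tensorState_antisymmetricProjectorState hD⟩,
    ⟨g, hG, hR, tendsto_relativeEntropyOfEntanglement_copies hd hR⟩,
    trace_antisymmetricProjector d N,
    ⟨relativeEntropyOfEntanglement_antisymmetricProjectorState hd,
      logGlobalRobustness_antisymmetricProjectorState_eq_sub hd,
      logGlobalRobustness_antisymmetricProjectorState hd⟩,
    ⟨relativeEntropyOfEntanglement_tensorState_antisymmetricProjectorState fun _ => hd,
      logGlobalRobustness_copies_antisymmetricProjectorState 2 hd,
      logGlobalRobustness_copies_two_antisymmetricProjectorState hd hd0⟩,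
    isClosestProductState_antisymmetricProjectorState_iff hd,
    fun ψ hψ => hψ.isClosestProductState_copies_two hd hd0,
    fun hN3 φ hφ => exists_isMaximallyEntangled_of_isClosestProductState_copies_two hN3 hd hφ⟩
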